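/- Let $e$ be a unit vector of $\mathbb{R}^3$ (the vertical direction), let $\overline S\subset e^{\perp}$ be a simple closed curve with a regular $C^2$ periodic parametrization, and let $S=\overline S+\mathbb{R}e$ be the vertical cylinder with cross-section $\overline S$. Let $\nu$ be a continuous unit normal field of $S$ (the inward one if the ball rolls inside the cylinder, the outward one if it rolls outside). A ball of mass $m>0$ and radius $r>0$, with mass distribution parameter $\gamma>0$ (so that the second moment matrix per unit mass is $\frac12 (r\gamma)^2 I$), has configurations $q=(A,a)\in SO(3)\times S$, where $a$ is the position of its center and $A$ its rotation. Tangent vectors to $SO(3)\times S$ at $q$ are written $(UA,u)$ with $U\in\mathfrak{so}(3)$, $u\in T_aS$. The kinetic energy metric is $$\langle (UA,u),(VA,v)\rangle=m\left\{\tfrac{(r\gamma)^2}{2}\operatorname{Tr}(UV^{\dagger})+u\cdot v\right\}$$ with Levi-Civita connection $\nabla$, and the no-slip space is $\mathfrak{S}_q=\{(UA,u): u=rU\nu_a\}$. A rolling motion under the constant axial force $\varphi e$, $\varphi\in\mathbb{R}$, is a $C^2$ path $q(t)=(A(t),a(t))$ in $SO(3)\times S$, defined for $t$ in an interval $I\subset\mathbb{R}$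 (bounded or not), such that for all $t\in I$ $$\dot q(t)\in\mathfrak{S}_{q(t)},\qquad \frac{\nabla\dot q}{dt}=m^{-1}(0,\varphi e)+N(t),$$ with $N(t)$ tangent to $SO(3)\times S$ and orthogonal to $\mathfrak{S}_{q(t)}$ for the kinetic energy metric. Its angular velocity vector $\omega(t)$ is defined by $\dot A A^{-1}w=\omega\times w$ for all $w\in\mathbb{R}^3$. Then for every rolling motion the vertical component $\omega_e=\omega\cdot e$ of the angular velocity is constant in time, and if $\omega_e\neq0$ then the trajectory is bounded: $\{a(t):t\in I\}$ is a bounded subset of $\mathbb{R}^3$. -/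

import Mathlib

open Matrix Set

/-- Vectors of Euclidean 3-space; the Euclidean inner product is `⬝ᵥ`, the cross product `⨯₃`. -/
abbrev Vec3 := Fin 3 → ℝ

/-- Real 3 × 3 matrices. -/
abbrev Mat3 := Matrix (Fin 3) (Fin 3) ℝ

/-- `c` is an `L`-periodic regular parametrization of class `C²` of a simple closed curve lying in
the plane through the origin orthogonal to the axis `e`. -/
structure IsCrossSection (e : Vec3) (c : ℝ → Vec3) (L : ℝ) : Prop where
  pos : 0 < L
  contDiff : ContDiff ℝ 2 c
  periodic : Function.Periodic c L
  injOn : InjOn c (Ico 0 L)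
  regular : ∀ s, deriv c s ≠ 0
  perp : ∀ s, c s ⬝ᵥ e = 0

/-- The cylinder `S` with axis `e` over the curve `c`. -/
def cylinder (e : Vec3) (c : ℝ → Vec3) : Set Vec3 :=
  {a | ∃ s h : ℝ, a = c s + h • e}

/-- The tangent plane `T_a S` of the cylinder at a point `a` of it. -/
def tangentCylinder (e : Vec3) (c : ℝ → Vec3) (a : Vec3) : Submodule ℝ Vec3 :=
  Submodule.span ℝ ({e} ∪ {v | ∃ s h : ℝ, a = c s + h • e ∧ v = deriv c s})

/-- `ν` is a continuous unit normal field on the cylinder. There are two of them: the inward one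
(ball inside the cylinder) and the outward one (ball outside). -/
structure IsUnitNormal (e : Vec3) (c : ℝ → Vec3) (ν : Vec3 → Vec3) : Prop where
  continuousOn : ContinuousOn ν (cylinder e c)
  unit : ∀ a ∈ cylinder e c, ν a ⬝ᵥ ν a = 1
  normal : ∀ a ∈ cylinder e c, ∀ v ∈ tangentCylinder e c a, ν a ⬝ᵥ v = 0

/-- The kinetic energy inner product of a ball of mass `m`, radius `r` and mass distribution
parameter `γ`, written on the ambient space `Mat3 × Vec3`. For tangent vectors `(U A, u)`,
`(V A, v)` at `(A, a)` with `A` a rotation it is `m ((r γ)² / 2 * tr (U Vᵀ) + u · v)`. -/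
noncomputable def kineticInner (m r γ : ℝ) (ξ η : Mat3 × Vec3) : ℝ :=
  m * ((r * γ) ^ 2 / 2 * (ξ.1 * η.1ᵀ).trace + ξ.2 ⬝ᵥ η.2)

/-- The tangent space of `SO(3) × S` at `q = (A, a)`: the vectors `(U A, u)` with `U`
skew-symmetric and `u` tangent to the cylinder. -/
def configTangent (e : Vec3) (c : ℝ → Vec3) (q : Mat3 × Vec3) : Set (Mat3 × Vec3) :=
  {ξ | (∃ U : Mat3, Uᵀ = -U ∧ ξ.1 = U * q.1) ∧ ξ.2 ∈ tangentCylinder e c q.2}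

/-- The no-slip space at `q = (A, a)`: the vectors `(U A, u)` with `U` skew-symmetric and
`u = r U ν_a`, i.e. the point of contact `a - r ν_a` has velocity zero. -/
def noSlip (r : ℝ) (ν : Vec3 → Vec3) (q : Mat3 × Vec3) : Set (Mat3 × Vec3) :=
  {ξ | ∃ U : Mat3, Uᵀ = -U ∧ ξ.1 = U * q.1 ∧ ξ.2 = r • (U *ᵥ ν q.2)}

/-- The vectors tangent to `SO(3) × S` at `q` which are orthogonal, for the kinetic energy inner
product, to the no-slip space: the possible directions of the constraint force. -/
def noSlipPerp (m r γ : ℝ) (e : Vec3) (c : ℝ → Vec3) (ν : Vec3 → Vec3) (q : Mat3 × Vec3) :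
    Set (Mat3 × Vec3) :=
  {ξ ∈ configTangent e c q | ∀ η ∈ noSlip r ν q, kineticInner m r γ ξ η = 0}

/-- Derivative of a path in `Mat3 × Vec3` along the time interval `I`, entry by entry. -/
noncomputable def pathDeriv (I : Set ℝ) (q : ℝ → Mat3 × Vec3) (t : ℝ) : Mat3 × Vec3 :=
  (Matrix.of fun i j => derivWithin (fun s => (q s).1 i j) I t,
    fun i => derivWithin (fun s => (q s).2 i) I t)

/-- `W` is the covariant acceleration `∇q̇/dt` at time `t` of the path `q` in `SO(3) × S`, for the
Levi-Civita connection of the kinetic energy metric: the orthogonal projection of the ambient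
second derivative to the tangent space of `SO(3) × S`. -/
def IsCovariantAcceleration (m r γ : ℝ) (e : Vec3) (c : ℝ → Vec3) (I : Set ℝ)
    (q : ℝ → Mat3 × Vec3) (t : ℝ) (W : Mat3 × Vec3) : Prop :=
  W ∈ configTangent e c (q t) ∧
    ∀ ξ ∈ configTangent e c (q t), kineticInner m r γ (pathDeriv I (pathDeriv I q) t - W) ξ = 0

/-- `q = (A, a)` is a rolling motion, on the time interval `I`, of a ball of mass `m`, radius `r`
and mass distribution parameter `γ` on the cylinder, under the constant force `φ e` applied to its
center: a path of class `C²` in `SO(3) × S`, with velocity in the no-slip spaces, that satisfies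
the constrained Newton equation `∇q̇/dt = m⁻¹ f + N`, where `f = (0, φ e)` and `N` is orthogonal to
the no-slip space. -/
structure IsRollingMotion (m r γ φ : ℝ) (e : Vec3) (c : ℝ → Vec3) (ν : Vec3 → Vec3)
    (I : Set ℝ) (q : ℝ → Mat3 × Vec3) : Prop where
  rotation : ∀ t ∈ I, (q t).1 ∈ Matrix.specialOrthogonalGroup (Fin 3) ℝ
  mem_cylinder : ∀ t ∈ I, (q t).2 ∈ cylinder e c
  contDiffOn_rotation : ∀ i j, ContDiffOn ℝ 2 (fun t => (q t).1 i j) I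
  contDiffOn_center : ∀ i, ContDiffOn ℝ 2 (fun t => (q t).2 i) I
  noSlip : ∀ t ∈ I, pathDeriv I q t ∈ noSlip r ν (q t)
  newton : ∀ t ∈ I, ∃ W N : Mat3 × Vec3,
    IsCovariantAcceleration m r γ e c I q t W ∧ N ∈ noSlipPerp m r γ e c ν (q t) ∧
      W = m⁻¹ • ((0 : Mat3), φ • e) + N

/-- The vector `ω` with `U w = ω × w` for all `w`, for a skew-symmetric matrix `U`. -/
def axialVector (U : Mat3) : Vec3 := ![U 2 1, U 0 2, U 1 0]

theorem mulVec_eq_axialVector_cross (U : Mat3) (hU : Uᵀ = -U) (w : Vec3) :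
    U *ᵥ w = axialVector U ⨯₃ w := by
  have h : ∀ i j, U j i = -U i j := fun i j => congrFun (congrFun hU i) j
  have h00 := h 0 0
  have h11 := h 1 1
  have h22 := h 2 2
  have z0 : U 0 0 = 0 := by linarith
  have z1 : U 1 1 = 0 := by linarith
  have z2 : U 2 2 = 0 := by linarith
  ext i
  fin_cases i <;>
    simp [axialVector, cross_apply, Matrix.mulVec, dotProduct, Fin.sum_univ_three,
      z0, z1, z2, h 1 0, h 2 1, h 0 2] <;> ring

/-- The angular velocity vector `ω` of the motion: `U = Ȧ A⁻¹` is `w ↦ ω × w`. -/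
noncomputable def angularVelocity (I : Set ℝ) (q : ℝ → Mat3 × Vec3) (t : ℝ) : Vec3 :=
  axialVector ((pathDeriv I q t).1 * ((q t).1)⁻¹)

/-! Write `n` for the normal at the center `a`, `g = φ / m`, `k = ω · e`. Testing Newton's equation
on no-slip vectors removes the reaction `N` and the normal part of the ambient acceleration, leaving
an equation for `ω` and `a` alone (`IsRollingMotion.exists_isReducedMotion`). With test vector `e`
it gives `k k' = 0`, so `k` is constant and the projection of the center moves along the
cross-section at constant speed `r |k|`.

Let `θ` be the tangent angle at the contact generator, and let `x`, `y` be the components of `ω`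
along the horizontal tangent and along the normal, up to a common sign. The other test vectors give
`x' = -η² θ' y - G`, `y' = θ' x`, and the height satisfies `h' = -r x`, where `η² = γ² / (1 + γ²)`
and `G = g / (r (1 + γ²))`. Hence `z = x + i η y` solves `z' = i η θ' z - G`, and `z exp (-iηθ)` has
derivative `-G exp (-iηθ)`.

So everything rests on a bounded primitive of `exp (-iηθ)`. By Hopf's theorem
(`exists_tangent_angle`) a full turn of the curve changes `θ` by `±2π` and multiplies the integrand
by `exp (∓2πiη)`, which is not `1` because `0 < η < 1`. The integrals over successive turns
therefore do not accumulate (`exists_norm_integral_exp_angle_le`). Thus `z` is bounded, and the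
height is controlled by energy if `G ≠ 0` and by the same primitive if `G = 0`
(`exists_abs_height_sub_le`). -/

/-! ### Continuous logarithms and angles -/

theorem exists_continuous_log {X : Type*} [TopologicalSpace X] [SimplyConnectedSpace X]
    [LocallyPathConnectedSpace X] {f : X → ℂ} (hf : Continuous f) (h0 : ∀ x, f x ≠ 0) :
    ∃ ψ : X → ℂ, Continuous ψ ∧ ∀ x, Complex.exp (ψ x) = f x := by
  obtain ⟨x₀⟩ : Nonempty X := inferInstance
  obtain ⟨ψ, ⟨-, hψ⟩, -⟩ := Complex.isCoveringMapOn_exp.existsUnique_continuousMap_lifts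
    ⟨f, hf⟩ (a₀ := x₀) (Complex.exp_log (h0 x₀)) h0
  exact ⟨ψ, ψ.continuous, fun x => congrFun hψ x⟩

/-- A continuous angle that goes from `0` to `π` modulo `2π` through angles with nonnegative sine
increases by `π`. -/
theorem eq_add_pi_of_sin_nonneg {f : ℝ → ℝ} {L : ℝ} (hL : 0 ≤ L) (hf : ContinuousOn f (Icc 0 L))
    (hsin : ∀ u ∈ Icc 0 L, 0 ≤ Real.sin (f u)) (h0 : Real.cos (f 0) = 1)
    (h1 : Real.cos (f L) = -1) : f L = f 0 + Real.pi := by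
  have hπ := Real.pi_pos
  obtain ⟨n, hn⟩ := (Real.cos_eq_one_iff _).1 h0
  have h1' : Real.cos (f L - Real.pi) = 1 := by rw [Real.cos_sub_pi, h1, neg_neg]
  obtain ⟨k, hk⟩ := (Real.cos_eq_one_iff _).1 h1'
  -- Every angle between `f 0` and `f L` is attained. An increment other than `π` would force `f 0 -
  -- π/2` or `f 0 + 3π/2` to be attained, where the sine is `-1`.
  have key : ∀ x y : ℝ, x ∈ uIcc (f 0) (f L) → x = y + n * (2 * Real.pi) → 0 ≤ Real.sin y := by
    intro x y hx hxy
    have hIVT := intermediate_value_uIcc (a := (0 : ℝ)) (b := L) (f := f)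
      (by rwa [uIcc_of_le hL])
    obtain ⟨u, hu, rfl⟩ := hIVT hx
    rw [uIcc_of_le hL] at hu
    have := hsin u hu
    rwa [hxy, Real.sin_add_int_mul_two_pi] at this
  rcases lt_trichotomy k n with h | h | h
  · exfalso
    have hkn : (k : ℝ) + 1 ≤ n := by exact_mod_cast h
    have := key (f 0 - Real.pi / 2) (-(Real.pi / 2))
      (by rw [mem_uIcc]; right; constructor <;> nlinarith) (by rw [← hn]; ring)
    rw [Real.sin_neg, Real.sin_pi_div_two] at this
    linarith
  · subst h; linarith
  · exfalso
    have hkn : (n : ℝ) + 1 ≤ k := by exact_mod_cast h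
    have := key (f 0 + 3 * Real.pi / 2) (Real.pi / 2 + Real.pi)
      (by rw [mem_uIcc]; left; constructor <;> nlinarith) (by rw [← hn]; ring)
    rw [Real.sin_add_pi, Real.sin_pi_div_two] at this
    linarith

/-- A continuous angle with nonnegative sine and opposite cosines `±1` at the ends changes by `±π`,
the sign being that of the initial cosine. -/
theorem eq_add_cos_mul_pi_of_sin_nonneg {f : ℝ → ℝ} {L : ℝ} (hL : 0 ≤ L)
    (hf : ContinuousOn f (Icc 0 L)) (hsin : ∀ u ∈ Icc 0 L, 0 ≤ Real.sin (f u)) {σ : ℝ}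
    (hσ : σ = 1 ∨ σ = -1) (h0 : Real.cos (f 0) = σ) (h1 : Real.cos (f L) = -σ) :
    f L = f 0 + σ * Real.pi := by
  rcases hσ with rfl | rfl
  · rw [one_mul]; exact eq_add_pi_of_sin_nonneg hL hf hsin h0 h1
  · have := eq_add_pi_of_sin_nonneg (f := fun u => Real.pi - f u) hL (continuousOn_const.sub hf)
      (fun u hu => by rw [Real.sin_pi_sub]; exact hsin u hu)
      (by rw [Real.cos_pi_sub, h0, neg_neg]) (by rw [Real.cos_pi_sub, h1, neg_neg])
    linarith

/-- Two logarithms of the same function differ by a continuous function with values in the discrete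
set `2πiℤ`. -/
theorem eq_of_exp_eq_exp_of_continuous {X : Type*} [TopologicalSpace X] [PreconnectedSpace X]
    {f g : X → ℂ} (hf : Continuous f) (hg : Continuous g)
    (h : ∀ x, Complex.exp (f x) = Complex.exp (g x)) (x y : X) : f x - g x = f y - g y := by
  have hc : ∀ x, ∃ n : ℤ, f x - g x = n * (2 * Real.pi * Complex.I) := fun x => by
    obtain ⟨n, hn⟩ := Complex.exp_eq_exp_iff_exists_int.1 (h x)
    exact ⟨n, by rw [hn]; ring⟩
  choose n hn using hc
  have hπ : (2 * Real.pi * Complex.I : ℂ) ≠ 0 := Complex.two_pi_I_ne_zero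
  have hcont : Continuous fun x => (n x : ℝ) := by
    have : (fun x => (n x : ℝ)) = fun x => ((f x - g x) / (2 * Real.pi * Complex.I)).re := by
      funext x
      rw [hn x, mul_div_cancel_right₀ _ hπ]
      simp
    rw [this]
    fun_prop
  have hn' : Continuous n := Int.isClosedEmbedding_coe_real.isEmbedding.continuous_iff.2 hcont
  rw [hn, hn, PreconnectedSpace.constant inferInstance hn' (x := x) (y := y)]

/-! ### Hopf's theorem on turning tangents -/

/-- The mean of the derivative of `c` over the segment from `s` to `s + σ`. -/
noncomputable def meanVelocity (c : ℝ → ℂ) (s σ : ℝ) : ℂ := ∫ u in (0 : ℝ)..1, deriv c (s + u * σ)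

theorem continuous_meanVelocity {c : ℝ → ℂ} (hc : ContDiff ℝ 1 c) :
    Continuous fun p : ℝ × ℝ => meanVelocity c p.1 p.2 := by
  have h := hc.continuous_deriv le_rfl
  unfold meanVelocity
  refine intervalIntegral.continuous_parametric_intervalIntegral_of_continuous'
    (f := fun (p : ℝ × ℝ) (u : ℝ) => deriv c (p.1 + u * p.2)) ?_ 0 1
  unfold Function.uncurry
  fun_prop

theorem mul_meanVelocity {c : ℝ → ℂ} (hc : ContDiff ℝ 1 c) (s σ : ℝ) :
    (σ : ℂ) * meanVelocity c s σ = c (s + σ) - c s := by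
  have h := hc.continuous_deriv le_rfl
  have hd : ∀ u : ℝ, HasDerivAt (fun u : ℝ => c (s + u * σ)) (σ * deriv c (s + u * σ)) u := by
    intro u
    have h1 : HasDerivAt c (deriv c (s + u * σ)) (s + u * σ) :=
      (hc.differentiable one_ne_zero _).hasDerivAt
    have h2 : HasDerivAt (fun u : ℝ => s + u * σ) σ u := by
      simpa using ((hasDerivAt_id u).mul_const σ).const_add s
    simpa [Function.comp_def] using h1.scomp u h2
  have hint := intervalIntegral.integral_eq_sub_of_hasDerivAt (a := 0) (b := 1)
    (fun u _ => hd u) (Continuous.intervalIntegrable (by fun_prop) _ _)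
  rw [meanVelocity, ← intervalIntegral.integral_const_mul, hint]
  simp

theorem exists_eq_add_int_mul_of_injOn {E : Type*} {c : ℝ → E} {L : ℝ} (hL : 0 < L)
    (hper : Function.Periodic c L) (hinj : InjOn c (Ico 0 L)) {s t : ℝ} (h : c s = c t) :
    ∃ n : ℤ, s = t + n * L := by
  have hm : ∀ s, c (toIcoMod hL 0 s) = c s := fun s => by
    rw [toIcoMod]; exact hper.sub_zsmul_eq _
  have hmem : ∀ s, toIcoMod hL 0 s ∈ Ico 0 L := fun s => by
    simpa using toIcoMod_mem_Ico hL 0 s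
  have := hinj (hmem s) (hmem t) (by rw [hm, hm, h])
  rw [toIcoMod, toIcoMod] at this
  refine ⟨toIcoDiv hL 0 s - toIcoDiv hL 0 t, ?_⟩
  simp only [zsmul_eq_mul] at this
  push_cast
  linarith

section Curve

variable {c : ℝ → ℂ} {L : ℝ}

/-- The rescaled chord from `c s` to `c (s + σ)`; at `σ = 0` and `σ = L` it is tangent. -/
noncomputable def chord (c : ℝ → ℂ) (L s σ : ℝ) : ℂ :=
  meanVelocity c s σ - meanVelocity c s (σ - L)

/-- Partial fractions: `1/σ - 1/(σ - L) = L / (σ (L - σ))`. Dividing the chord by `σ (L - σ)`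
cancels its zeros at both ends and preserves its direction in between. -/
theorem mul_chord (hc : ContDiff ℝ 1 c) (hper : Function.Periodic c L) (s σ : ℝ) :
    (σ * (L - σ) : ℂ) * chord c L s σ = L * (c (s + σ) - c s) := by
  have h1 := mul_meanVelocity hc s σ
  have h2 := mul_meanVelocity hc s (σ - L)
  rw [← add_sub_assoc, hper.sub_eq] at h2
  push_cast at h2
  rw [chord]
  linear_combination (L - σ : ℂ) * h1 + σ * h2

theorem chord_zero (hL : 0 < L) (hc : ContDiff ℝ 1 c) (hper : Function.Periodic c L) (s : ℝ) :
    chord c L s 0 = deriv c s := by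
  have h2 := mul_meanVelocity hc s (0 - L)
  rw [← add_sub_assoc, hper.sub_eq, add_zero, sub_self] at h2
  have h3 : meanVelocity c s (0 - L) = 0 := by
    refine (mul_eq_zero.1 h2).resolve_left ?_
    simpa using hL.ne'
  rw [chord, h3, meanVelocity]
  simp

theorem chord_period (hL : 0 < L) (hc : ContDiff ℝ 1 c) (hper : Function.Periodic c L) (s : ℝ) :
    chord c L s L = -deriv c s := by
  have h2 := mul_meanVelocity hc s L
  rw [hper s, sub_self] at h2
  have h3 : meanVelocity c s L = 0 := by
    refine (mul_eq_zero.1 h2).resolve_left ?_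
    simpa using hL.ne'
  rw [chord, h3, meanVelocity]
  simp

/-- Regularity handles the two ends, where the chord is tangent; simplicity of the curve handles the
interior. -/
theorem chord_ne_zero (hL : 0 < L) (hc : ContDiff ℝ 1 c) (hper : Function.Periodic c L)
    (hinj : InjOn c (Ico 0 L)) (hreg : ∀ s, deriv c s ≠ 0) (s : ℝ) {σ : ℝ} (hσ : σ ∈ Icc 0 L) :
    chord c L s σ ≠ 0 := by
  rcases hσ.1.eq_or_lt with rfl | h0
  · rw [chord_zero hL hc hper]; exact hreg s
  rcases hσ.2.eq_or_lt with rfl | h1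
  · rw [chord_period hL hc hper]; exact neg_ne_zero.2 (hreg s)
  intro h
  have h2 := mul_chord hc hper s σ
  rw [h, mul_zero, eq_comm, mul_eq_zero, sub_eq_zero] at h2
  have h3 := h2.resolve_left (by exact_mod_cast hL.ne')
  obtain ⟨n, hn⟩ := exists_eq_add_int_mul_of_injOn hL hper hinj h3
  have hn' : σ = n * L := by linarith
  have a1 : (0 : ℝ) < n := by
    by_contra! hneg
    nlinarith
  have a2 : (n : ℝ) < 1 := by
    by_contra! hneg
    nlinarith
  have b1 : 0 < n := by exact_mod_cast a1
  have b2 : n < 1 := by exact_mod_cast a2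
  omega

theorem exp_eq_norm_mul_exp {z w : ℂ} (h : Complex.exp z = w) :
    w = ‖w‖ * Complex.exp (z.im * Complex.I) := by
  rw [← h, Complex.norm_exp, Complex.ofReal_exp, ← Complex.exp_add, Complex.re_add_im]

/-- Hopf's theorem on turning tangents: along a simple closed regular curve the angle of the
tangent changes by `2π` or by `-2π`. -/
theorem exists_tangent_angle (hL : 0 < L) (hc : ContDiff ℝ 1 c) (hper : Function.Periodic c L)
    (hinj : InjOn c (Ico 0 L)) (hreg : ∀ s, deriv c s ≠ 0) :
    ∃ Θ : ℝ → ℝ, Continuous Θ ∧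
      (∀ s, deriv c s = ‖deriv c s‖ * Complex.exp (Θ s * Complex.I)) ∧
      ∃ σ : ℝ, (σ = 1 ∨ σ = -1) ∧ ∀ s, Θ (s + L) = Θ s + σ * (2 * Real.pi) := by
  have hcl : ∀ u : ℝ, max 0 (min u L) ∈ Icc 0 L := fun u =>
    ⟨le_max_left _ _, max_le hL.le (min_le_right _ _)⟩
  have hcl' : ∀ u ∈ Icc 0 L, max 0 (min u L) = u := fun u hu => by
    rw [min_eq_left hu.2, max_eq_right hu.1]
  -- Clamping the second variable to `[0, L]` extends the nonvanishing chord from the strip to the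
  -- simply connected plane.
  obtain ⟨ψ, hψ, hψe⟩ := exists_continuous_log
    (f := fun p : ℝ × ℝ => chord c L p.1 (max 0 (min p.2 L)))
    (by
      have h1 := continuous_meanVelocity hc
      unfold chord
      exact (h1.comp (f := fun p : ℝ × ℝ => (p.1, max 0 (min p.2 L))) (by fun_prop)).sub
        (h1.comp (f := fun p : ℝ × ℝ => (p.1, max 0 (min p.2 L) - L)) (by fun_prop)))
    (fun p => chord_ne_zero hL hc hper hinj hreg p.1 (hcl p.2))
  have hψ' : ∀ s, ∀ u ∈ Icc 0 L, Complex.exp (ψ (s, u)) = chord c L s u := fun s u hu => by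
    have := hψe (s, u)
    rwa [hcl' u hu] at this
  have hψ0 : ∀ s, Complex.exp (ψ (s, 0)) = deriv c s := fun s => by
    rw [hψ' s 0 ⟨le_rfl, hL.le⟩, chord_zero hL hc hper]
  have hψL : ∀ s, Complex.exp (ψ (s, L)) = -deriv c s := fun s => by
    rw [hψ' s L ⟨hL.le, le_rfl⟩, chord_period hL hc hper]
  have hdper : ∀ s, deriv c (s + L) = deriv c s := fun s => by
    rw [← deriv_comp_add_const]
    congr 1
    exact funext hper
  -- the point of the curve where the imaginary part is minimal
  obtain ⟨s₀, hs₀⟩ : ∃ s₀, ∀ s, (c s₀).im ≤ (c s).im := by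
    have hcc := hc.continuous
    obtain ⟨s₀, -, h⟩ := isCompact_Icc.exists_isMinOn (nonempty_Icc.2 hL.le)
      (f := fun s => (c s).im) (s := Icc 0 L) (by fun_prop)
    refine ⟨s₀, fun s => ?_⟩
    have hm : c (toIcoMod hL 0 s) = c s := by rw [toIcoMod]; exact hper.sub_zsmul_eq _
    have hmem : toIcoMod hL 0 s ∈ Icc 0 L := by
      have := toIcoMod_mem_Ico hL 0 s
      rw [zero_add] at this
      exact Ico_subset_Icc_self this
    have := h hmem
    simpa [hm] using this
  have him : (deriv c s₀).im = 0 := by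
    have h1 : HasDerivAt c (deriv c s₀) s₀ := (hc.differentiable one_ne_zero _).hasDerivAt
    have h2 : HasDerivAt (fun s => (c s).im) (deriv c s₀).im s₀ :=
      (Complex.imCLM.hasFDerivAt.comp_hasDerivAt s₀ h1)
    exact (show IsLocalMin (fun s => (c s).im) s₀ from
      Filter.Eventually.of_forall hs₀).hasDerivAt_eq_zero h2
  have hreal : deriv c s₀ = ((deriv c s₀).re : ℂ) := by
    apply Complex.ext <;> simp [him]
  obtain ⟨σ, hσ, hσd⟩ : ∃ σ : ℝ, (σ = 1 ∨ σ = -1) ∧ (deriv c s₀).re = ‖deriv c s₀‖ * σ := by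
    rw [hreal, Complex.norm_real, Complex.ofReal_re, Real.norm_eq_abs]
    rcases le_total 0 (deriv c s₀).re with h | h
    · exact ⟨1, Or.inl rfl, by rw [abs_of_nonneg h, mul_one]⟩
    · exact ⟨-1, Or.inr rfl, by rw [abs_of_nonpos h]; ring⟩
  have hpos : 0 < ‖deriv c s₀‖ := norm_pos_iff.2 (hreg s₀)
  have hcos : ∀ z w : ℂ, Complex.exp z = w → ‖w‖ * Real.cos z.im = w.re := fun z w h => by
    rw [← h, Complex.norm_exp, Complex.exp_re]
  have hsin : ∀ z w : ℂ, Complex.exp z = w → ‖w‖ * Real.sin z.im = w.im := fun z w h => by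
    rw [← h, Complex.norm_exp, Complex.exp_im]
  have hcos1 : ∀ z : ℂ, Complex.exp z = deriv c s₀ → Real.cos z.im = σ := fun z h =>
    mul_left_cancel₀ hpos.ne' ((hcos z _ h).trans hσd)
  have hcos2 : ∀ z : ℂ, Complex.exp z = -deriv c s₀ → Real.cos z.im = -σ := fun z h => by
    have h1 := hcos z _ h
    rw [norm_neg, Complex.neg_re, hσd, ← mul_neg] at h1
    exact mul_left_cancel₀ hpos.ne' h1
  -- sign of the imaginary part of chords with an end at `c s₀`
  have hchord_im : ∀ s, ∀ u ∈ Icc 0 L, ∀ ε : ℝ, (ε = 1 ∨ ε = -1) →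
      0 ≤ ε * ((c (s + u)).im - (c s).im) →
      (u = 0 ∨ u = L → (chord c L s u).im = 0) → 0 ≤ ε * (chord c L s u).im := by
    intro s u hu ε hε h hend
    by_cases h01 : u = 0 ∨ u = L
    · rw [hend h01, mul_zero]
    · push Not at h01
      have h0 : 0 < u := lt_of_le_of_ne hu.1 (Ne.symm h01.1)
      have h1 : 0 < L - u := sub_pos.2 (lt_of_le_of_ne hu.2 h01.2)
      have hm := congrArg Complex.im (mul_chord hc hper s u)
      rw [← Complex.ofReal_sub, ← Complex.ofReal_mul, Complex.im_ofReal_mul, Complex.im_ofReal_mul,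
        Complex.sub_im] at hm
      have hp : 0 < u * (L - u) := mul_pos h0 h1
      have : 0 ≤ u * (L - u) * (ε * (chord c L s u).im) := by
        have : u * (L - u) * (ε * (chord c L s u).im) = L * (ε * ((c (s + u)).im - (c s).im)) := by
          linear_combination ε * hm
        rw [this]
        exact mul_nonneg hL.le h
      exact nonneg_of_mul_nonneg_right this hp
  -- From the lowest point all chords point upward, so while the second end runs around the curve
  -- the angle makes a half turn, from the tangent to its opposite.
  have half1 : (ψ (s₀, L)).im = (ψ (s₀, 0)).im + σ * Real.pi := by
    refine eq_add_cos_mul_pi_of_sin_nonneg (f := fun u => (ψ (s₀, u)).im) hL.le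
      (by fun_prop) (fun u hu => ?_) hσ (hcos1 _ (hψ0 s₀)) (hcos2 _ (hψL s₀))
    have h1 := hsin _ _ (hψ' s₀ u hu)
    have h2 := hchord_im s₀ u hu 1 (Or.inl rfl) (by rw [one_mul]; linarith [hs₀ (s₀ + u)]) (by
      rintro (rfl | rfl)
      · rw [chord_zero hL hc hper, him]
      · rw [chord_period hL hc hper, Complex.neg_im, him, neg_zero])
    rw [one_mul, ← h1] at h2
    exact nonneg_of_mul_nonneg_right h2 (norm_pos_iff.2 (chord_ne_zero hL hc hper hinj hreg _ hu))
  -- Now the first end runs around the curve while the second stays at the lowest point: the chords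
  -- point downward, and the angle shifted by `-π` has nonnegative sine.
  have half2 : (ψ (s₀ + L, 0)).im = (ψ (s₀, L)).im + σ * Real.pi := by
    have := eq_add_cos_mul_pi_of_sin_nonneg
      (f := fun u => (ψ (s₀ + u, L - u)).im - Real.pi) hL.le
      (by fun_prop) (fun u hu => ?_) hσ ?_ ?_
    · simp only [sub_self, add_zero, sub_zero] at this
      linarith
    · have hu' : L - u ∈ Icc 0 L := ⟨by linarith [hu.2], by linarith [hu.1]⟩
      have h1 := hsin _ _ (hψ' (s₀ + u) (L - u) hu')
      have h2 := hchord_im (s₀ + u) (L - u) hu' (-1) (Or.inr rfl) (by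
        have : s₀ + u + (L - u) = s₀ + L := by ring
        rw [this, hper]
        linarith [hs₀ (s₀ + u)]) (by
        rintro (h | h)
        · have h' : u = L := by linarith
          rw [h, chord_zero hL hc hper, h', hdper, him]
        · have h' : u = 0 := by linarith
          rw [h, chord_period hL hc hper, h', add_zero, Complex.neg_im, him, neg_zero])
      rw [← h1] at h2
      rw [Real.sin_sub_pi]
      refine nonneg_of_mul_nonneg_right (a := ‖chord c L (s₀ + u) (L - u)‖) (by linarith)
        (norm_pos_iff.2 (chord_ne_zero hL hc hper hinj hreg _ hu'))
    · simp only [add_zero, sub_zero]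
      rw [Real.cos_sub_pi, hcos2 _ (hψL s₀), neg_neg]
    · simp only [sub_self]
      rw [Real.cos_sub_pi, hcos1 _ ((hψ0 _).trans (hdper s₀))]
  refine ⟨fun s => (ψ (s, 0)).im, by fun_prop, fun s => exp_eq_norm_mul_exp (hψ0 s), σ, hσ,
    fun s => ?_⟩
  -- The increment of the angle over a period does not depend on the starting point, so computing it
  -- at `s₀` suffices.
  have hconst := eq_of_exp_eq_exp_of_continuous (f := fun s => ψ (s + L, 0))
    (g := fun s => ψ (s, 0)) (by fun_prop) (by fun_prop)
    (fun s => by rw [hψ0, hψ0, hdper]) s s₀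
  have := congrArg Complex.im hconst
  simp only [Complex.sub_im] at this
  linarith

end Curve

/-! ### Differentiable angles and lifts of paths -/

/-- Near `s` the quotient `f u / f s` is close to `1`, and by continuity of `Θ` its principal
argument is `Θ u - Θ s`; so `Θ` inherits the derivative of the principal logarithm. -/
theorem hasDerivAt_angle {f : ℝ → ℂ} {Θ : ℝ → ℝ} {s : ℝ} {f' : ℂ} (hΘ : ContinuousAt Θ s)
    (h : ∀ u, f u = ‖f u‖ * Complex.exp (Θ u * Complex.I)) (hf : HasDerivAt f f' s)
    (h0 : f s ≠ 0) : HasDerivAt Θ (f' / f s).im s := by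
  have h1 : HasDerivAt (fun u => Complex.log (f u / f s)) (f' / f s / (f s / f s)) s :=
    (hf.div_const (f s)).clog_real (by rw [div_self h0]; exact Complex.one_mem_slitPlane)
  rw [div_self h0, div_one] at h1
  have h2 : HasDerivAt (fun u => (Complex.log (f u / f s)).im) (f' / f s).im s :=
    Complex.imCLM.hasFDerivAt.comp_hasDerivAt s h1
  have h3 := h2.const_add (Θ s)
  refine h3.congr_of_eventuallyEq ?_
  have hne : ∀ᶠ u in nhds s, f u ≠ 0 := hf.continuousAt.eventually_ne h0
  have hnear : ∀ᶠ u in nhds s, |Θ u - Θ s| < Real.pi := by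
    have := Metric.continuousAt_iff'.1 hΘ Real.pi Real.pi_pos
    simpa [Real.dist_eq] using this
  filter_upwards [hne, hnear] with u hu hn
  have hq : f u / f s = ((‖f u‖ / ‖f s‖ : ℝ) : ℂ) *
      Complex.exp (((Θ u - Θ s : ℝ) : ℂ) * Complex.I) := by
    have e1 : Complex.exp (((Θ u - Θ s : ℝ) : ℂ) * Complex.I)
        = Complex.exp (Θ u * Complex.I) / Complex.exp (Θ s * Complex.I) := by
      rw [← Complex.exp_sub]; push_cast; ring_nf
    rw [e1, h u, h s]
    simp only [Complex.norm_mul, Complex.norm_real, norm_norm, Complex.norm_exp_ofReal_mul_I,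
      mul_one]
    push_cast
    have : (‖f s‖ : ℂ) ≠ 0 := by exact_mod_cast norm_ne_zero_iff.2 h0
    have := Complex.exp_ne_zero (Θ s * Complex.I)
    field_simp
  rw [Complex.log_im, hq, Complex.arg_real_mul _ (div_pos (norm_pos_iff.2 hu) (norm_pos_iff.2 h0)),
    Complex.arg_exp_mul_I, (toIocMod_eq_self _).2]
  · ring
  · rw [abs_lt] at hn
    constructor <;> linarith [hn.1, hn.2]

/-- A path in a simple closed curve lifts to the parameter line. -/
theorem exists_lift_of_mem_range {E : Type*} [TopologicalSpace E] [T2Space E] {c : ℝ → E} {L : ℝ}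
    (hL : 0 < L) (hc : Continuous c) (hper : Function.Periodic c L) (hinj : InjOn c (Ico 0 L))
    {p : ℝ → E} (hp : Continuous p) (hmem : ∀ t, p t ∈ range c) :
    ∃ s : ℝ → ℝ, Continuous s ∧ ∀ t, c (s t) = p t := by
  have : Fact (0 < L) := ⟨hL⟩
  let F : AddCircle L → E := hper.lift
  have hF : ∀ s : ℝ, F (s : AddCircle L) = c s := fun s => hper.lift_coe s
  have hFc : Continuous F := by
    refine (QuotientAddGroup.isQuotientMap_mk _).continuous_iff.2 ?_
    have : (F ∘ fun s : ℝ => (s : AddCircle L)) = c := funext hF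
    exact this ▸ hc
  have hFi : Function.Injective F := by
    intro a b hab
    induction a using QuotientAddGroup.induction_on with | H a =>
    induction b using QuotientAddGroup.induction_on with | H b =>
    obtain ⟨n, hn⟩ := exists_eq_add_int_mul_of_injOn hL hper hinj
      ((hF a).symm.trans (hab.trans (hF b)))
    subst hn
    change ((b + n * L : ℝ) : AddCircle L) = (b : AddCircle L)
    rw [AddCircle.coe_add, ← zsmul_eq_mul, AddCircle.coe_zsmul, AddCircle.coe_period, smul_zero,
      add_zero]
  -- An injective continuous map from the compact circle to a Hausdorff space is an embedding, so
  -- the path is continuous in the circle and lifts through the covering by the line.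
  have hemb := (hFc.isClosedEmbedding hFi).isEmbedding
  have hex : ∀ t, ∃ a, F a = p t := fun t => by
    obtain ⟨s, hs⟩ := hmem t
    exact ⟨s, (hF s).trans hs⟩
  choose a ha using hex
  have hac : Continuous a := by
    rw [hemb.continuous_iff]
    exact (funext ha : F ∘ a = p) ▸ hp
  obtain ⟨s₀, hs₀⟩ := QuotientAddGroup.mk_surjective (a 0)
  obtain ⟨s, ⟨-, hs⟩, -⟩ := (AddCircle.isCoveringMap_coe L).existsUnique_continuousMap_lifts
    ⟨a, hac⟩ 0 s₀ hs₀
  refine ⟨s, s.continuous, fun t => ?_⟩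
  rw [← ha t, ← hF]
  exact congrArg F (congrFun hs t)

theorem exists_lift_on_Icc {E : Type*} [TopologicalSpace E] [T2Space E] {c : ℝ → E} {L : ℝ}
    (hL : 0 < L) (hc : Continuous c) (hper : Function.Periodic c L) (hinj : InjOn c (Ico 0 L))
    {a b : ℝ} (hab : a ≤ b) {p : ℝ → E} (hp : ContinuousOn p (Icc a b))
    (hmem : ∀ t ∈ Icc a b, p t ∈ range c) :
    ∃ s : ℝ → ℝ, Continuous s ∧ ∀ t ∈ Icc a b, c (s t) = p t := by
  obtain ⟨s, hs, h⟩ := exists_lift_of_mem_range hL hc hper hinj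
    (p := fun t => p (projIcc a b hab t))
    (hp.comp_continuous (continuous_subtype_val.comp continuous_projIcc) fun t => Subtype.coe_prop _)
    fun t => hmem _ (Subtype.coe_prop _)
  exact ⟨s, hs, fun t ht => by rw [h t, projIcc_of_mem hab ht]⟩

/-- Projecting `c` to its tangent direction at `s t` gives a real function with nonzero derivative.
Its local inverse expresses `s` through `p`, which makes the merely continuous lift differentiable.
-/
theorem hasDerivWithinAt_of_comp_curve {c p : ℝ → ℂ} {s : ℝ → ℝ} {J : Set ℝ} {t : ℝ} {p' : ℂ}
    (hc : ContDiff ℝ 1 c) (hreg : deriv c (s t) ≠ 0) (hs : ContinuousWithinAt s J t)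
    (h : ∀ u ∈ J, c (s u) = p u) (ht : t ∈ J) (hJ : UniqueDiffWithinAt ℝ J t)
    (hp : HasDerivWithinAt p p' J t) :
    ∃ s' : ℝ, HasDerivWithinAt s s' J t ∧ (s' : ℂ) * deriv c (s t) = p' := by
  set d := deriv c (s t) with hd
  let ℓ : ℂ →L[ℝ] ℝ := Complex.reCLM.comp
    ((ContinuousLinearMap.mul ℂ ℂ ((starRingEnd ℂ) d)).restrictScalars ℝ)
  have hℓ : ∀ z, ℓ z = ((starRingEnd ℂ) d * z).re := fun z => rfl
  have hℓd : ℓ d ≠ 0 := by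
    rw [hℓ, ← Complex.normSq_eq_conj_mul_self, Complex.ofReal_re]
    exact fun h => hreg (Complex.normSq_eq_zero.1 h)
  have h1 : HasStrictDerivAt c d (s t) := hc.contDiffAt.hasStrictDerivAt one_ne_zero
  have h2 : HasStrictDerivAt (fun u => ℓ (c u)) (ℓ d) (s t) :=
    ℓ.hasStrictFDerivAt.comp_hasStrictDerivAt _ h1
  have h3 := h2.to_localInverse hℓd
  have h4 := h2.eventually_left_inverse hℓd
  have h5 : HasDerivWithinAt (fun u => ℓ (p u)) (ℓ p') J t :=
    ℓ.hasFDerivAt.comp_hasDerivWithinAt t hp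
  have h6 : HasDerivWithinAt s ((ℓ d)⁻¹ * ℓ p') J t := by
    have h3' := h3.hasDerivAt
    rw [h t ht] at h3'
    refine (h3'.comp_hasDerivWithinAt t h5).congr_of_eventuallyEq ?_ ?_
    · filter_upwards [hs.eventually h4, self_mem_nhdsWithin] with u hu huJ
      rw [Function.comp_apply, ← h u huJ, hu]
    · rw [Function.comp_apply, ← h t ht, h4.self_of_nhds]
  refine ⟨_, h6, ?_⟩
  have h7 := h1.hasDerivAt.scomp_hasDerivWithinAt t h6
  have h8 := h7.congr_of_eventuallyEq (f₁ := p) (by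
    filter_upwards [self_mem_nhdsWithin] with u hu using (h u hu).symm) (h t ht).symm
  rw [← Complex.real_smul]
  exact hJ.eq_deriv _ h8 hp

/-! ### The forced oscillator -/

theorem eq_of_hasDerivWithinAt_zero {E : Type*} [NormedAddCommGroup E] [NormedSpace ℝ E]
    {J : Set ℝ} (hJ : J.OrdConnected) {f : ℝ → E} (hf : ∀ t ∈ J, HasDerivWithinAt f 0 J t)
    {t u : ℝ} (ht : t ∈ J) (hu : u ∈ J) : f t = f u := by
  have := hJ.convex.norm_image_sub_le_of_norm_hasDerivWithin_le (C := 0) hf (by simp) hu ht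
  rw [zero_mul] at this
  exact sub_eq_zero.1 (norm_le_zero_iff.1 this)

/-- The integrand satisfies `f (u + L) = ζ f u` with `|ζ| = 1` and `ζ ≠ 1`, so its primitive obeys
`P (s + L) = P L + ζ P s`. This is a rotation about a fixed point `p`; hence `|P - p|` is periodic
and continuous. -/
theorem exists_norm_integral_exp_angle_le {Θ ρ : ℝ → ℝ} {L η σ : ℝ} (hL : 0 < L)
    (hΘ : Continuous Θ) (hρ : Continuous ρ) (hρper : Function.Periodic ρ L)
    (hσ : σ = 1 ∨ σ = -1) (hΘper : ∀ s, Θ (s + L) = Θ s + σ * (2 * Real.pi))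
    (hη0 : 0 < η) (hη1 : η < 1) :
    ∃ M, ∀ s : ℝ, ‖∫ u in (0 : ℝ)..s, (ρ u : ℂ) * Complex.exp (-(η * Θ u * Complex.I))‖ ≤ M := by
  set f : ℝ → ℂ := fun u => (ρ u : ℂ) * Complex.exp (-(η * Θ u * Complex.I)) with hf
  have hfc : Continuous f := by fun_prop
  set ζ : ℂ := Complex.exp (-(η * (σ * (2 * Real.pi)) * Complex.I)) with hζ
  -- `ζ = 1` would make `ησ` an integer, impossible for `σ = ±1` and `0 < η < 1`.
  have hζ1 : 1 - ζ ≠ 0 := by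
    intro h
    have h1 : ζ = 1 := (sub_eq_zero.1 h).symm
    obtain ⟨n, hn⟩ := Complex.exp_eq_one_iff.1 h1
    have h2 : -(η * σ) = (n : ℝ) := by
      have h3 : ((-(η * σ) : ℝ) : ℂ) * (2 * Real.pi * Complex.I)
          = ((n : ℝ) : ℂ) * (2 * Real.pi * Complex.I) := by
        push_cast
        rw [← hn]; ring
      exact_mod_cast mul_right_cancel₀ Complex.two_pi_I_ne_zero h3
    rcases hσ with rfl | rfl
    · have a1 : (-1 : ℝ) < n := by linarith
      have a2 : (n : ℝ) < 0 := by linarith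
      have b1 : -1 < n := by exact_mod_cast a1
      have b2 : n < 0 := by exact_mod_cast a2
      omega
    · have a1 : (0 : ℝ) < n := by linarith
      have a2 : (n : ℝ) < 1 := by linarith
      have b1 : 0 < n := by exact_mod_cast a1
      have b2 : n < 1 := by exact_mod_cast a2
      omega
  have hζn : ‖ζ‖ = 1 := by
    have : ζ = Complex.exp (((-(η * (σ * (2 * Real.pi))) : ℝ) : ℂ) * Complex.I) := by
      rw [hζ]; push_cast; ring_nf
    rw [this, Complex.norm_exp_ofReal_mul_I]
  have hfs : ∀ u, f (u + L) = ζ * f u := fun u => by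
    simp only [hf, hζ]
    rw [hρper u, hΘper, mul_left_comm _ (ρ u : ℂ), ← Complex.exp_add]
    push_cast
    ring_nf
  set P : ℝ → ℂ := fun s => ∫ u in (0 : ℝ)..s, f u with hP
  have hPc : Continuous P := intervalIntegral.continuous_primitive
    (fun _ _ => hfc.intervalIntegrable _ _) 0
  have hPs : ∀ s, P (s + L) = P L + ζ * P s := fun s => by
    simp only [hP]
    rw [← intervalIntegral.integral_add_adjacent_intervals (b := L) (hfc.intervalIntegrable _ _)
      (hfc.intervalIntegrable _ _), ← intervalIntegral.integral_const_mul]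
    congr 1
    simp_rw [← hfs]
    rw [intervalIntegral.integral_comp_add_right, zero_add]
  set p : ℂ := P L / (1 - ζ) with hp
  have hfix : p = P L + ζ * p := by
    rw [hp]; field_simp; ring
  have hper : Function.Periodic (fun s => ‖P s - p‖) L := fun s => by
    have : P (s + L) - p = ζ * (P s - p) := by
      rw [hPs]; linear_combination -hfix
    simp only [this, norm_mul, hζn, one_mul]
  have hb := hper.isBounded_of_continuous hL.ne' (by fun_prop)
  obtain ⟨M, hM⟩ := hb.exists_norm_le
  refine ⟨M + ‖p‖, fun s => ?_⟩
  have h1 : ‖P s - p‖ ≤ M := by simpa using hM _ ⟨s, rfl⟩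
  calc ‖P s‖ = ‖(P s - p) + p‖ := by rw [sub_add_cancel]
    _ ≤ ‖P s - p‖ + ‖p‖ := norm_add_le _ _
    _ ≤ M + ‖p‖ := by linarith

/-- The height `h` of a forced oscillator with phase `θ` stays within a bound that depends only on
the parameters, on the initial amplitude and on a bound of a primitive of `exp (-iηθ)`. -/
theorem exists_abs_height_sub_le (η g r κ M Z : ℝ) (hκ : κ ≠ 0) :
    ∃ B, ∀ (J : Set ℝ) (x y h θ θ' : ℝ → ℝ) (Q : ℝ → ℂ), J.OrdConnected →
      (∀ t ∈ J, HasDerivWithinAt x (-η ^ 2 * θ' t * y t - g) J t) →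
      (∀ t ∈ J, HasDerivWithinAt y (θ' t * x t) J t) →
      (∀ t ∈ J, HasDerivWithinAt h (-r * x t) J t) →
      (∀ t ∈ J, HasDerivWithinAt θ (θ' t) J t) →
      (∀ t ∈ J, HasDerivWithinAt Q (κ * Complex.exp (-(η * θ t * Complex.I))) J t) →
      (∀ t ∈ J, ‖Q t‖ ≤ M) →
      ∀ t₀ ∈ J, ‖(x t₀ + η * y t₀ * Complex.I : ℂ)‖ ≤ Z → ∀ t ∈ J, |h t - h t₀| ≤ B := by
  refine ⟨if g = 0 then |r / κ| * (Z * (M + M)) else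
    |r / (2 * g)| * ((Z + |g / κ| * (M + M)) ^ 2 + Z ^ 2), ?_⟩
  intro J x y h θ θ' Q hJ hx hy hh hθ hQ hM t₀ ht₀ hZ t ht
  have hM0 : 0 ≤ M := (norm_nonneg _).trans (hM t₀ ht₀)
  have hZ0 : 0 ≤ Z := (norm_nonneg _).trans hZ
  set E : ℝ → ℂ := fun t => Complex.exp (-(η * θ t * Complex.I)) with hE
  set z : ℝ → ℂ := fun t => x t + η * y t * Complex.I with hz
  have hEn : ∀ t, ‖E t‖ = 1 := fun t => by
    have : E t = Complex.exp (((-(η * θ t) : ℝ) : ℂ) * Complex.I) := by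
      rw [hE]; push_cast; ring_nf
    rw [this, Complex.norm_exp_ofReal_mul_I]
  have hEd : ∀ t ∈ J, HasDerivWithinAt E (E t * (-(η * θ' t * Complex.I))) J t := fun t ht => by
    exact ((((hθ t ht).ofReal_comp.const_mul (η : ℂ)).mul_const Complex.I).neg).cexp
  have hzd : ∀ t ∈ J, HasDerivWithinAt z (η * θ' t * Complex.I * z t - g) J t := fun t ht => by
    refine ((hx t ht).ofReal_comp.add (((hy t ht).ofReal_comp.const_mul (η : ℂ)).mul_const
      Complex.I)).congr_deriv ?_
    simp only [hz]
    push_cast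
    linear_combination (-η ^ 2 * θ' t * y t : ℂ) * Complex.I_sq
  have hκ' : (κ : ℂ) ≠ 0 := by exact_mod_cast hκ
  -- Variation of constants: `z E` has derivative `-g E`, and `Q / κ` is a primitive of `E`.
  have hconst : ∀ t ∈ J, z t * E t + (g / κ) * Q t = z t₀ * E t₀ + (g / κ) * Q t₀ := fun t ht => by
    refine eq_of_hasDerivWithinAt_zero hJ (f := fun t => z t * E t + (g / κ) * Q t) ?_ ht ht₀
    intro t ht
    refine (((hzd t ht).mul (hEd t ht)).add ((hQ t ht).const_mul (g / κ : ℂ))).congr_deriv ?_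
    change _ + (g / κ : ℂ) * (κ * E t) = 0
    field_simp
    ring
  have hQd : ∀ t ∈ J, ‖Q t₀ - Q t‖ ≤ M + M := fun t ht =>
    (norm_sub_le _ _).trans (add_le_add (hM _ ht₀) (hM _ ht))
  by_cases hg : g = 0
  · rw [if_pos hg]
    subst hg
    set C : ℂ := z t₀ * E t₀ with hC
    have hC' : ∀ t ∈ J, z t * E t = C := fun t ht => by simpa using hconst t ht
    have hCn : ‖C‖ ≤ Z := by rw [hC, norm_mul, hEn, mul_one]; exact hZ
    have hxE : ∀ t ∈ J, x t = ((starRingEnd ℂ) C * E t).re := fun t ht => by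
      have h1 : (starRingEnd ℂ) C * E t = (starRingEnd ℂ) (z t) := by
        rw [← hC' t ht, map_mul, mul_assoc, ← Complex.normSq_eq_conj_mul_self,
          Complex.normSq_eq_norm_sq, hEn]
        simp
      rw [h1, Complex.conj_re]
      simp [hz]
    -- Without force `z E` is a constant `C`, so `x = Re (conj C * E)`, and the height is an
    -- explicit linear function of `Q` up to a constant.
    have hcons : h t + (r / κ) * ((starRingEnd ℂ) C * Q t).re
        = h t₀ + (r / κ) * ((starRingEnd ℂ) C * Q t₀).re := by
      refine eq_of_hasDerivWithinAt_zero hJ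
        (f := fun t => h t + (r / κ) * ((starRingEnd ℂ) C * Q t).re) ?_ ht ht₀
      intro t ht
      have h1 : HasDerivWithinAt (fun t => ((starRingEnd ℂ) C * Q t).re)
          ((starRingEnd ℂ) C * (κ * E t)).re J t :=
        Complex.reCLM.hasFDerivAt.comp_hasDerivWithinAt t ((hQ t ht).const_mul _)
      refine ((hh t ht).add (h1.const_mul (r / κ))).congr_deriv ?_
      rw [mul_left_comm, Complex.re_ofReal_mul, ← hxE t ht]
      field_simp
      ring
    have h2 : h t - h t₀ = (r / κ) * ((starRingEnd ℂ) C * (Q t₀ - Q t)).re := by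
      rw [mul_sub, Complex.sub_re]; linarith
    rw [h2, abs_mul]
    refine mul_le_mul_of_nonneg_left ?_ (abs_nonneg _)
    refine (Complex.abs_re_le_norm _).trans ?_
    rw [norm_mul, RCLike.norm_conj]
    exact mul_le_mul hCn (hQd t ht) (norm_nonneg _) hZ0
  · rw [if_neg hg]
    have hzn : ‖z t‖ ≤ Z + |g / κ| * (M + M) := by
      have h1 : z t * E t = z t₀ * E t₀ + (g / κ) * (Q t₀ - Q t) := by
        linear_combination hconst t ht
      calc ‖z t‖ = ‖z t * E t‖ := by rw [norm_mul, hEn, mul_one]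
        _ ≤ ‖z t₀ * E t₀‖ + ‖(g / κ : ℂ) * (Q t₀ - Q t)‖ := by rw [h1]; exact norm_add_le _ _
        _ ≤ Z + |g / κ| * (M + M) := by
          rw [norm_mul, hEn, mul_one, norm_mul]
          refine add_le_add hZ (mul_le_mul ?_ (hQd t ht) (norm_nonneg _) (abs_nonneg _))
          rw [← Complex.ofReal_div, Complex.norm_real, Real.norm_eq_abs]
    have hsq : ∀ t, ‖z t‖ ^ 2 = x t ^ 2 + η ^ 2 * y t ^ 2 := fun t => by
      rw [← Complex.normSq_eq_norm_sq, Complex.normSq_apply]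
      simp [hz]
      ring
    -- Energy conservation: `x² + η² y²` has derivative `-2 g x`, proportional to `h' = -r x`.
    have hcons : h t - r / (2 * g) * (x t ^ 2 + η ^ 2 * y t ^ 2)
        = h t₀ - r / (2 * g) * (x t₀ ^ 2 + η ^ 2 * y t₀ ^ 2) := by
      refine eq_of_hasDerivWithinAt_zero hJ
        (f := fun t => h t - r / (2 * g) * (x t ^ 2 + η ^ 2 * y t ^ 2)) ?_ ht ht₀
      intro t ht
      refine ((hh t ht).sub ((((hx t ht).pow 2).add
        (((hy t ht).pow 2).const_mul (η ^ 2))).const_mul (r / (2 * g)))).congr_deriv ?_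
      field_simp
      ring
    rw [← hsq, ← hsq] at hcons
    have h2 : h t - h t₀ = r / (2 * g) * (‖z t‖ ^ 2 - ‖z t₀‖ ^ 2) := by linarith
    rw [h2, abs_mul]
    refine mul_le_mul_of_nonneg_left ?_ (abs_nonneg _)
    have h3 : ‖z t‖ ^ 2 ≤ (Z + |g / κ| * (M + M)) ^ 2 := pow_le_pow_left₀ (norm_nonneg _) hzn 2
    have h4 : ‖z t₀‖ ^ 2 ≤ Z ^ 2 := pow_le_pow_left₀ (norm_nonneg _) hZ 2
    rw [abs_le]
    constructor <;> nlinarith [sq_nonneg ‖z t‖, sq_nonneg ‖z t₀‖]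

/-! ### Orthonormal frames -/

section Vectors

theorem HasDerivWithinAt.dotProduct {f g : ℝ → Vec3} {f' g' : Vec3} {J : Set ℝ} {t : ℝ}
    (hf : HasDerivWithinAt f f' J t) (hg : HasDerivWithinAt g g' J t) :
    HasDerivWithinAt (fun u => f u ⬝ᵥ g u) (f' ⬝ᵥ g t + f t ⬝ᵥ g') J t := by
  rw [hasDerivWithinAt_pi] at hf hg
  simp only [_root_.dotProduct, ← Finset.sum_add_distrib]
  exact HasDerivWithinAt.fun_sum fun i _ => (hf i).mul (hg i)

theorem HasDerivWithinAt.dotProduct_const {f : ℝ → Vec3} {f' : Vec3} {J : Set ℝ} {t : ℝ}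
    (hf : HasDerivWithinAt f f' J t) (v : Vec3) :
    HasDerivWithinAt (fun u => f u ⬝ᵥ v) (f' ⬝ᵥ v) J t := by
  simpa using hf.dotProduct (hasDerivWithinAt_const t J v)

/-- Three orthonormal vectors. -/
structure IsFrame (u v w : Vec3) : Prop where
  uu : u ⬝ᵥ u = 1
  vv : v ⬝ᵥ v = 1
  ww : w ⬝ᵥ w = 1
  uv : u ⬝ᵥ v = 0
  uw : u ⬝ᵥ w = 0
  vw : v ⬝ᵥ w = 0

theorem IsFrame.expand {u v w : Vec3} (h : IsFrame u v w) (x : Vec3) :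
    x = (x ⬝ᵥ u) • u + (x ⬝ᵥ v) • v + (x ⬝ᵥ w) • w := by
  let M : Mat3 := Matrix.of ![u, v, w]
  have h1 : M * Mᵀ = 1 := by
    ext i j
    have : (M * Mᵀ) i j = M i ⬝ᵥ M j := rfl
    rw [this]
    have hvu := h.uv
    have hwu := h.uw
    have hwv := h.vw
    rw [dotProduct_comm] at hvu hwu hwv
    fin_cases i <;> fin_cases j <;> simp [M]
    exacts [h.uu, h.uv, h.uw, hvu, h.vv, h.vw, hwu, hwv, h.ww]
  have h2 : Mᵀ * M = 1 := mul_eq_one_comm.1 h1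
  have h3 : Mᵀ *ᵥ (M *ᵥ x) = x := by rw [mulVec_mulVec, h2, one_mulVec]
  conv_lhs => rw [← h3]
  ext i
  simp [M, mulVec, _root_.dotProduct, Fin.sum_univ_three]
  ring

theorem IsFrame.parseval {u v w : Vec3} (h : IsFrame u v w) (x y : Vec3) :
    x ⬝ᵥ y = (x ⬝ᵥ u) * (y ⬝ᵥ u) + (x ⬝ᵥ v) * (y ⬝ᵥ v) + (x ⬝ᵥ w) * (y ⬝ᵥ w) := by
  have hx := congrArg (· ⬝ᵥ y) (h.expand x)
  simp only [add_dotProduct, smul_dotProduct, smul_eq_mul] at hx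
  rw [hx, dotProduct_comm u y, dotProduct_comm v y, dotProduct_comm w y]

theorem isFrame_cross {e n : Vec3} (he : e ⬝ᵥ e = 1) (hn : n ⬝ᵥ n = 1) (hne : n ⬝ᵥ e = 0) :
    IsFrame e n (e ⨯₃ n) where
  uu := he
  vv := hn
  ww := by rw [cross_dot_cross, he, hn, hne, dotProduct_comm, hne]; ring
  uv := by rw [dotProduct_comm, hne]
  uw := dot_self_cross e n
  vw := dot_cross_self e n

end Vectors

/-! ### Tangent planes of the cylinder -/

section Cylinder

variable {e : Vec3} {c : ℝ → Vec3} {L : ℝ} {ν : Vec3 → Vec3}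

theorem IsCrossSection.deriv_dot_axis (hc : IsCrossSection e c L) (s : ℝ) :
    deriv c s ⬝ᵥ e = 0 := by
  have h1 : HasDerivWithinAt c (deriv c s) univ s :=
    (hc.contDiff.differentiable two_ne_zero s).hasDerivAt.hasDerivWithinAt
  have h2 := h1.dotProduct_const e
  simp only [hc.perp] at h2
  exact uniqueDiffWithinAt_univ.eq_deriv _ h2 (hasDerivWithinAt_const _ _ _)

theorem axis_mem_tangentCylinder (a : Vec3) : e ∈ tangentCylinder e c a :=
  Submodule.subset_span (Or.inl rfl)

theorem deriv_mem_tangentCylinder (s h : ℝ) : deriv c s ∈ tangentCylinder e c (c s + h • e) :=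
  Submodule.subset_span (Or.inr ⟨s, h, rfl, rfl⟩)

theorem IsUnitNormal.dot_axis (hν : IsUnitNormal e c ν) {a : Vec3} (ha : a ∈ cylinder e c) :
    ν a ⬝ᵥ e = 0 :=
  hν.normal a ha e (axis_mem_tangentCylinder a)

theorem IsUnitNormal.dot_deriv (hν : IsUnitNormal e c ν) (s h : ℝ) :
    ν (c s + h • e) ⬝ᵥ deriv c s = 0 :=
  hν.normal _ ⟨s, h, rfl⟩ _ (deriv_mem_tangentCylinder s h)

theorem mem_tangentCylinder_of_dot_normal_eq_zero (he : e ⬝ᵥ e = 1) (hc : IsCrossSection e c L)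
    (hν : IsUnitNormal e c ν) {a v : Vec3} (ha : a ∈ cylinder e c) (hv : v ⬝ᵥ ν a = 0) :
    v ∈ tangentCylinder e c a := by
  have hf := isFrame_cross he (hν.unit a ha) (hν.dot_axis ha)
  obtain ⟨s, h, rfl⟩ := ha
  have hd := hf.expand (deriv c s)
  rw [hc.deriv_dot_axis, dotProduct_comm _ (ν _), hν.dot_deriv, zero_smul, zero_smul, zero_add,
    zero_add] at hd
  set τ := e ⨯₃ ν (c s + h • e)
  have h0 : deriv c s ⬝ᵥ τ ≠ 0 := fun h0 => hc.regular s (by rw [hd, h0, zero_smul])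
  have hτ : τ ∈ tangentCylinder e c (c s + h • e) := by
    have h1 : τ = (deriv c s ⬝ᵥ τ)⁻¹ • deriv c s := by
      nth_rewrite 2 [hd]
      rw [smul_smul, inv_mul_cancel₀ h0, one_smul]
    rw [h1]
    exact Submodule.smul_mem _ _ (deriv_mem_tangentCylinder s h)
  rw [hf.expand v, hv, zero_smul, add_zero]
  exact Submodule.add_mem _ (Submodule.smul_mem _ _ (axis_mem_tangentCylinder _))
    (Submodule.smul_mem _ _ hτ)

end Cylinder

/-! ### Reduced equations and the axial angular velocity -/

section Motion

theorem hasDerivWithinAt_of_contDiffOn_two {f : ℝ → ℝ} {I : Set ℝ} (hI : UniqueDiffOn ℝ I)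
    (hf : ContDiffOn ℝ 2 f I) {t : ℝ} (ht : t ∈ I) :
    HasDerivWithinAt f (derivWithin f I t) I t ∧
      HasDerivWithinAt (derivWithin f I) (derivWithin (derivWithin f I) I t) I t := by
  refine ⟨(hf.differentiableOn two_ne_zero t ht).hasDerivWithinAt, ?_⟩
  have h1 : ContDiffOn ℝ 1 (derivWithin f I) I := hf.derivWithin hI (by norm_num)
  exact (h1.differentiableOn one_ne_zero t ht).hasDerivWithinAt

/-- The skew-symmetric matrix of the map `w ↦ v × w`. -/
def crossMatrix (v : Vec3) : Mat3 := !![0, -v 2, v 1; v 2, 0, -v 0; -v 1, v 0, 0]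

theorem crossMatrix_transpose (v : Vec3) : (crossMatrix v)ᵀ = -crossMatrix v := by
  ext i j
  fin_cases i <;> fin_cases j <;> simp [crossMatrix]

theorem crossMatrix_mulVec (v w : Vec3) : crossMatrix v *ᵥ w = v ⨯₃ w := by
  rw [mulVec_eq_axialVector_cross _ (crossMatrix_transpose v)]
  congr 1

/-- Pairing with a skew-symmetric matrix sees only the skew part of `M`. -/
theorem trace_mul_crossMatrix_transpose (M : Mat3) (v : Vec3) :
    (M * (crossMatrix v)ᵀ).trace = axialVector (M - Mᵀ) ⬝ᵥ v := by
  simp [Matrix.trace, Fin.sum_univ_three, Matrix.mul_apply, crossMatrix, axialVector,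
    _root_.dotProduct]
  ring

theorem kineticInner_sub_left (m r γ : ℝ) (ξ ξ' η : Mat3 × Vec3) :
    kineticInner m r γ (ξ - ξ') η = kineticInner m r γ ξ η - kineticInner m r γ ξ' η := by
  simp only [kineticInner, Prod.fst_sub, Prod.snd_sub, Matrix.sub_mul, Matrix.trace_sub,
    sub_dotProduct]
  ring

theorem kineticInner_add_left (m r γ : ℝ) (ξ ξ' η : Mat3 × Vec3) :
    kineticInner m r γ (ξ + ξ') η = kineticInner m r γ ξ η + kineticInner m r γ ξ' η := by
  simp only [kineticInner, Prod.fst_add, Prod.snd_add, Matrix.add_mul, Matrix.trace_add,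
    add_dotProduct]
  ring

/-- The equations of motion in terms of the angular velocity `ω` and the center `a`. -/
structure IsReducedMotion (r γ g : ℝ) (e : Vec3) (I : Set ℝ) (ω ω' a a'' n : ℝ → Vec3) :
    Prop where
  center : ∀ t ∈ I, HasDerivWithinAt a (r • (ω t ⨯₃ n t)) I t
  angular : ∀ t ∈ I, HasDerivWithinAt ω (ω' t) I t
  velocity : ∀ t ∈ I, HasDerivWithinAt (fun t => r • (ω t ⨯₃ n t)) (a'' t) I t
  newton : ∀ t ∈ I, ∀ v : Vec3,
    (r * γ) ^ 2 * (ω' t ⬝ᵥ v) + r * ((a'' t - g • e) ⬝ᵥ (v ⨯₃ n t)) = 0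

/-- The test vectors `(V A, r V ν)`, with `V` the cross matrix of `v`, are both tangent and no-slip,
so the normal acceleration and `N` pair to zero with them. In the trace term `Ä Aᵀ = Ω' - Ȧ Ȧᵀ`: the
second summand is symmetric and drops out, leaving the angular acceleration. -/
theorem IsRollingMotion.exists_isReducedMotion {m r γ φ : ℝ} (hm : 0 < m) {e : Vec3}
    (he : e ⬝ᵥ e = 1) {c : ℝ → Vec3} {L : ℝ} (hc : IsCrossSection e c L) {ν : Vec3 → Vec3}
    (hν : IsUnitNormal e c ν) {I : Set ℝ} (hI : UniqueDiffOn ℝ I) {q : ℝ → Mat3 × Vec3}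
    (hq : IsRollingMotion m r γ φ e c ν I q) :
    ∃ ω' a'' : ℝ → Vec3, IsReducedMotion r γ (φ / m) e I (angularVelocity I q) ω'
      (fun t => (q t).2) a'' (fun t => ν (q t).2) := by
  set A : ℝ → Mat3 := fun t => (q t).1 with hA
  set A₁ : ℝ → Mat3 := fun t => (pathDeriv I q t).1 with hA₁
  set A₂ : ℝ → Mat3 := fun t => (pathDeriv I (pathDeriv I q) t).1 with hA₂
  set a : ℝ → Vec3 := fun t => (q t).2 with ha
  set a₁ : ℝ → Vec3 := fun t => (pathDeriv I q t).2 with ha₁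
  set a₂ : ℝ → Vec3 := fun t => (pathDeriv I (pathDeriv I q) t).2 with ha₂
  have dA : ∀ t ∈ I, ∀ i j, HasDerivWithinAt (fun t => A t i j) (A₁ t i j) I t ∧
      HasDerivWithinAt (fun t => A₁ t i j) (A₂ t i j) I t := fun t ht i j =>
    hasDerivWithinAt_of_contDiffOn_two hI (hq.contDiffOn_rotation i j) ht
  have da : ∀ t ∈ I, HasDerivWithinAt a (a₁ t) I t ∧ HasDerivWithinAt a₁ (a₂ t) I t := by
    intro t ht
    simp only [hasDerivWithinAt_pi]
    exact ⟨fun i => (hasDerivWithinAt_of_contDiffOn_two hI (hq.contDiffOn_center i) ht).1,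
      fun i => (hasDerivWithinAt_of_contDiffOn_two hI (hq.contDiffOn_center i) ht).2⟩
  have hAT : ∀ t ∈ I, A t * (A t)ᵀ = 1 := fun t ht =>
    (mem_orthogonalGroup_iff (Fin 3) ℝ).1 (mem_specialOrthogonalGroup_iff.1 (hq.rotation t ht)).1
  have hAinv : ∀ t ∈ I, (A t)⁻¹ = (A t)ᵀ := fun t ht => inv_eq_right_inv (hAT t ht)
  set Ω : ℝ → Mat3 := fun t => A₁ t * (A t)ᵀ with hΩ
  have hω : ∀ t ∈ I, angularVelocity I q t = axialVector (Ω t) := fun t ht => by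
    change axialVector (A₁ t * (A t)⁻¹) = _
    rw [hAinv t ht]
  have hslip : ∀ t ∈ I, (Ω t)ᵀ = -Ω t ∧ A₁ t = Ω t * A t ∧ a₁ t = r • (Ω t *ᵥ ν (a t)) := by
    intro t ht
    obtain ⟨U, hU, h1, h2⟩ := hq.noSlip t ht
    have : Ω t = U := by
      change (pathDeriv I q t).1 * (A t)ᵀ = U
      rw [h1, Matrix.mul_assoc, hAT t ht, Matrix.mul_one]
    rw [this]
    exact ⟨hU, h1, h2⟩
  set Ω' : ℝ → Mat3 := fun t => A₂ t * (A t)ᵀ + A₁ t * (A₁ t)ᵀ with hΩ'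
  have dΩ : ∀ t ∈ I, ∀ i j, HasDerivWithinAt (fun t => Ω t i j) (Ω' t i j) I t := by
    intro t ht i j
    have : Ω' t i j = ∑ k, (A₂ t i k * A t j k + A₁ t i k * A₁ t j k) := by
      simp only [hΩ', Matrix.add_apply, Matrix.mul_apply, Matrix.transpose_apply,
        Finset.sum_add_distrib]
    rw [this]
    simp only [hΩ, Matrix.mul_apply, Matrix.transpose_apply]
    exact HasDerivWithinAt.fun_sum fun k _ => (dA t ht i k).2.mul (dA t ht j k).1
  have hΩ'skew : ∀ t ∈ I, (Ω' t)ᵀ = -Ω' t := by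
    intro t ht
    ext i j
    have h1 : HasDerivWithinAt (fun t => Ω t j i) (-Ω' t i j) I t :=
      (dΩ t ht i j).fun_neg.congr (fun u hu => congrFun (congrFun (hslip u hu).1 i) j)
        (congrFun (congrFun (hslip t ht).1 i) j)
    exact (hI t ht).eq_deriv _ (dΩ t ht j i) h1
  have hvel : ∀ t ∈ I, a₁ t = r • (angularVelocity I q t ⨯₃ ν (a t)) := fun t ht => by
    rw [(hslip t ht).2.2, mulVec_eq_axialVector_cross _ (hslip t ht).1, hω t ht]
  refine ⟨fun t => axialVector (Ω' t), a₂, ?_, ?_, ?_, ?_⟩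
  · intro t ht
    exact hvel t ht ▸ (da t ht).1
  · intro t ht
    refine HasDerivWithinAt.congr (f := fun t => axialVector (Ω t)) ?_ (fun u hu => hω u hu)
      (hω t ht)
    rw [hasDerivWithinAt_pi]
    intro i
    fin_cases i
    · exact dΩ t ht 2 1
    · exact dΩ t ht 0 2
    · exact dΩ t ht 1 0
  · intro t ht
    exact (da t ht).2.congr (fun u hu => (hvel u hu).symm) (hvel t ht).symm
  · intro t ht v
    obtain ⟨W, N, hW, hN, hWN⟩ := hq.newton t ht
    set V := crossMatrix v
    have hVn : V *ᵥ ν (a t) = v ⨯₃ ν (a t) := crossMatrix_mulVec _ _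
    have hη₁ : ((V * A t, r • (V *ᵥ ν (a t))) : Mat3 × Vec3) ∈ _root_.noSlip r ν (q t) :=
      ⟨V, crossMatrix_transpose v, rfl, rfl⟩
    have hη₂ : ((V * A t, r • (V *ᵥ ν (a t))) : Mat3 × Vec3) ∈ configTangent e c (q t) := by
      refine ⟨⟨V, crossMatrix_transpose v, rfl⟩, Submodule.smul_mem _ _ ?_⟩
      refine mem_tangentCylinder_of_dot_normal_eq_zero he hc hν (hq.mem_cylinder t ht) ?_
      rw [hVn, dotProduct_comm]
      exact dot_cross_self _ _
    have h1 := hW.2 _ hη₂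
    have h2 := hN.2 _ hη₁
    rw [hWN, kineticInner_sub_left, kineticInner_add_left, h2] at h1
    have htr : (A₂ t * (V * A t)ᵀ).trace = 2 * (axialVector (Ω' t) ⬝ᵥ v) := by
      rw [Matrix.transpose_mul, ← Matrix.mul_assoc, trace_mul_crossMatrix_transpose]
      have h3 : A₂ t * (A t)ᵀ - (A₂ t * (A t)ᵀ)ᵀ = (2 : ℝ) • Ω' t := by
        have h4 : A₂ t * (A t)ᵀ = Ω' t - A₁ t * (A₁ t)ᵀ := by simp [hΩ']
        rw [h4, Matrix.transpose_sub, hΩ'skew t ht, Matrix.transpose_mul,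
          Matrix.transpose_transpose, two_smul]
        abel
      have h5 : axialVector ((2 : ℝ) • Ω' t) = (2 : ℝ) • axialVector (Ω' t) := by
        ext i; fin_cases i <;> simp [axialVector]
      rw [h3, h5, smul_dotProduct, smul_eq_mul]
    simp only [kineticInner, Prod.smul_mk, smul_zero, Matrix.zero_mul, Matrix.trace_zero, mul_zero,
      zero_add] at h1
    change m * ((r * γ) ^ 2 / 2 * (A₂ t * (V * A t)ᵀ).trace + a₂ t ⬝ᵥ r • (V *ᵥ ν (a t))) - _ = 0
      at h1
    rw [htr, hVn] at h1
    simp only [smul_dotProduct, dotProduct_smul, smul_eq_mul] at h1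
    simp only [sub_dotProduct, smul_dotProduct, smul_eq_mul]
    field_simp at h1 ⊢
    linarith

/-- The normal is only continuous, so the horizontal velocity is not differentiated along `e × n`.
Its square, `|u|² - (u · e)² = r² k²` with `u = r ω × n`, is differentiated instead; with Newton's
equation for `e` this gives `r² (1 + γ²) k k' = 0`. -/
theorem IsReducedMotion.axial_eq {r γ g : ℝ} (hr : 0 < r) {e : Vec3} (he : e ⬝ᵥ e = 1) {I : Set ℝ}
    (hI : UniqueDiffOn ℝ I) (hI' : I.OrdConnected) {ω ω' a a'' n : ℝ → Vec3}
    (h : IsReducedMotion r γ g e I ω ω' a a'' n) (hn : ∀ t ∈ I, n t ⬝ᵥ n t = 1)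
    (hne : ∀ t ∈ I, n t ⬝ᵥ e = 0) {t₁ t₂ : ℝ} (ht₁ : t₁ ∈ I) (ht₂ : t₂ ∈ I) :
    ω t₁ ⬝ᵥ e = ω t₂ ⬝ᵥ e := by
  have dk : ∀ t ∈ I, HasDerivWithinAt (fun t => ω t ⬝ᵥ e) (ω' t ⬝ᵥ e) I t := fun t ht =>
    (h.angular t ht).dotProduct_const e
  have hzero : ∀ t ∈ I, (ω t ⬝ᵥ e) * (ω' t ⬝ᵥ e) = 0 := by
    intro t ht
    have huτ : ∀ t ∈ I, (r • (ω t ⨯₃ n t)) ⬝ᵥ (e ⨯₃ n t) = r * (ω t ⬝ᵥ e) := by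
      intro t ht
      rw [smul_dotProduct, cross_dot_cross, hn t ht, hne t ht, smul_eq_mul]
      ring
    have hu : ∀ t ∈ I, ∀ x, (r • (ω t ⨯₃ n t)) ⬝ᵥ x = ((r • (ω t ⨯₃ n t)) ⬝ᵥ e) * (x ⬝ᵥ e) +
        r * (ω t ⬝ᵥ e) * (x ⬝ᵥ (e ⨯₃ n t)) := by
      intro t ht x
      rw [(isFrame_cross he (hn t ht) (hne t ht)).parseval _ x]
      have h1 : (r • (ω t ⨯₃ n t)) ⬝ᵥ n t = 0 := by
        rw [smul_dotProduct, dotProduct_comm, dot_cross_self, smul_zero]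
      rw [h1, huτ t ht]
      ring
    have d1 := ((h.velocity t ht).dotProduct (h.velocity t ht)).fun_sub
      (((h.velocity t ht).dotProduct_const e).fun_pow 2)
    have d2 := ((dk t ht).fun_pow 2).const_mul (r ^ 2)
    have d3 := d2.congr (f₁ := fun t => (r • (ω t ⨯₃ n t)) ⬝ᵥ (r • (ω t ⨯₃ n t)) -
      ((r • (ω t ⨯₃ n t)) ⬝ᵥ e) ^ 2)
      (fun u hu' => by rw [hu u hu' (r • (ω u ⨯₃ n u)), huτ u hu']; ring)
      (by rw [hu t ht (r • (ω t ⨯₃ n t)), huτ t ht]; ring)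
    have heq := (hI t ht).eq_deriv _ d1 d3
    rw [dotProduct_comm (a'' t), hu t ht] at heq
    have hN := h.newton t ht e
    rw [sub_dotProduct, smul_dotProduct, dot_self_cross, smul_zero, sub_zero] at hN
    have h5 : r ^ 2 * (1 + γ ^ 2) * ((ω t ⬝ᵥ e) * (ω' t ⬝ᵥ e)) = 0 := by
      simp only [Nat.cast_ofNat, Nat.add_one_sub_one, pow_one] at heq
      linear_combination (ω t ⬝ᵥ e) * hN - heq / 2
    refine (mul_eq_zero.1 h5).resolve_left ?_
    positivity
  have hsq : ∀ t ∈ I, ∀ u ∈ I, (ω t ⬝ᵥ e) ^ 2 = (ω u ⬝ᵥ e) ^ 2 := by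
    intro t ht u hu
    refine eq_of_hasDerivWithinAt_zero hI' (f := fun t => (ω t ⬝ᵥ e) ^ 2) ?_ ht hu
    intro t ht
    refine ((dk t ht).fun_pow 2).congr_deriv ?_
    simp only [Nat.cast_ofNat, Nat.add_one_sub_one, pow_one]
    linear_combination 2 * hzero t ht
  -- Only `k²` is known to be constant so far; continuity on the interval excludes a change of sign.
  by_cases h0 : ω t₂ ⬝ᵥ e = 0
  · have := hsq t₁ ht₁ t₂ ht₂
    rw [h0] at this ⊢
    exact pow_eq_zero_iff two_ne_zero |>.1 (this.trans (by norm_num))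
  · exact hI'.isPreconnected.eq_of_sq_eq (f := fun t => ω t ⬝ᵥ e) (g := fun _ => ω t₂ ⬝ᵥ e)
      (fun t ht => (dk t ht).continuousWithinAt) continuousOn_const
      (fun t ht => by simpa using hsq t ht t₂ ht₂) (fun _ => h0) ht₂ rfl ht₁

end Motion

/-! ### Complex coordinates and rotating frames in the horizontal plane -/

section Plane

/-- The coordinates of `v` along `e₁` and `e₂` as a complex number. -/
noncomputable def planeCoord (e₁ e₂ : Vec3) : Vec3 →L[ℝ] ℂ :=
  LinearMap.toContinuousLinearMap
    { toFun := fun v => ⟨v ⬝ᵥ e₁, v ⬝ᵥ e₂⟩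
      map_add' := fun v w => by apply Complex.ext <;> simp
      map_smul' := fun t v => by apply Complex.ext <;> simp }

theorem planeCoord_apply (e₁ e₂ v : Vec3) : planeCoord e₁ e₂ v = ⟨v ⬝ᵥ e₁, v ⬝ᵥ e₂⟩ := rfl

theorem IsFrame.eq_of_planeCoord_eq {e₁ e₂ e : Vec3} (hf : IsFrame e₁ e₂ e) {v w : Vec3}
    (h : planeCoord e₁ e₂ v = planeCoord e₁ e₂ w) (he : v ⬝ᵥ e = w ⬝ᵥ e) : v = w := by
  rw [planeCoord_apply, planeCoord_apply, Complex.mk.injEq] at h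
  rw [hf.expand v, hf.expand w, h.1, h.2, he]

/-- The unit vector at angle `θ` in the plane of `e₁` and `e₂`. -/
noncomputable def planeUnit (e₁ e₂ : Vec3) (θ : ℝ) : Vec3 := Real.cos θ • e₁ + Real.sin θ • e₂

/-- The unit vector at angle `θ - π / 2` in the plane of `e₁` and `e₂`. -/
noncomputable def planeNormal (e₁ e₂ : Vec3) (θ : ℝ) : Vec3 := Real.sin θ • e₁ - Real.cos θ • e₂

theorem IsFrame.plane {e₁ e₂ e : Vec3} (hf : IsFrame e₁ e₂ e) (θ : ℝ) :
    IsFrame e (planeUnit e₁ e₂ θ) (planeNormal e₁ e₂ θ) := by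
  have h1 := hf.uv
  have h2 := hf.uw
  have h3 := hf.vw
  rw [dotProduct_comm] at h1 h2 h3
  have h4 := Real.cos_sq_add_sin_sq θ
  constructor <;>
    simp only [planeUnit, planeNormal, add_dotProduct, sub_dotProduct, dotProduct_add,
      dotProduct_sub, smul_dotProduct, dotProduct_smul, hf.uu, hf.vv, hf.ww, hf.uv,
      h1, h2, h3, smul_eq_mul] <;> grind

theorem hasDerivWithinAt_dot_planeUnit {e₁ e₂ : Vec3} {ω : ℝ → Vec3} {ω' : Vec3} {θ : ℝ → ℝ}
    {θ' : ℝ} {J : Set ℝ} {t : ℝ} (hω : HasDerivWithinAt ω ω' J t)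
    (hθ : HasDerivWithinAt θ θ' J t) :
    HasDerivWithinAt (fun t => ω t ⬝ᵥ planeUnit e₁ e₂ (θ t))
      (ω' ⬝ᵥ planeUnit e₁ e₂ (θ t) - θ' * (ω t ⬝ᵥ planeNormal e₁ e₂ (θ t))) J t := by
  have h := (hθ.cos.mul (hω.dotProduct_const e₁)).add (hθ.sin.mul (hω.dotProduct_const e₂))
  simp only [planeUnit, planeNormal, dotProduct_add, dotProduct_sub, dotProduct_smul, smul_eq_mul]
  exact h.congr_deriv (by ring)

theorem hasDerivWithinAt_dot_planeNormal {e₁ e₂ : Vec3} {ω : ℝ → Vec3} {ω' : Vec3} {θ : ℝ → ℝ}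
    {θ' : ℝ} {J : Set ℝ} {t : ℝ} (hω : HasDerivWithinAt ω ω' J t)
    (hθ : HasDerivWithinAt θ θ' J t) :
    HasDerivWithinAt (fun t => ω t ⬝ᵥ planeNormal e₁ e₂ (θ t))
      (ω' ⬝ᵥ planeNormal e₁ e₂ (θ t) + θ' * (ω t ⬝ᵥ planeUnit e₁ e₂ (θ t))) J t := by
  have h := (hθ.sin.mul (hω.dotProduct_const e₁)).sub (hθ.cos.mul (hω.dotProduct_const e₂))
  simp only [planeUnit, planeNormal, dotProduct_add, dotProduct_sub, dotProduct_smul, smul_eq_mul]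
  exact h.congr_deriv (by ring)

theorem IsFrame.planeCoord_planeUnit {e₁ e₂ e : Vec3} (hf : IsFrame e₁ e₂ e) (θ : ℝ) :
    planeCoord e₁ e₂ (planeUnit e₁ e₂ θ) = Complex.exp (θ * Complex.I) := by
  have h21 := hf.uv
  rw [dotProduct_comm] at h21
  rw [planeCoord_apply, planeUnit, add_dotProduct, add_dotProduct]
  simp only [smul_dotProduct, hf.uu, hf.vv, hf.uv, h21, smul_eq_mul, mul_one, mul_zero, add_zero,
    zero_add]
  apply Complex.ext
  · rw [Complex.exp_ofReal_mul_I_re]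
  · rw [Complex.exp_ofReal_mul_I_im]

theorem abs_dot_planeUnit_le (e₁ e₂ v : Vec3) (θ : ℝ) :
    |v ⬝ᵥ planeUnit e₁ e₂ θ| ≤ |v ⬝ᵥ e₁| + |v ⬝ᵥ e₂| := by
  rw [planeUnit, dotProduct_add, dotProduct_smul, dotProduct_smul, smul_eq_mul, smul_eq_mul]
  refine (abs_add_le _ _).trans (add_le_add ?_ ?_) <;> rw [abs_mul] <;>
    refine mul_le_of_le_one_left (abs_nonneg _) ?_
  exacts [Real.abs_cos_le_one θ, Real.abs_sin_le_one θ]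

theorem abs_dot_planeNormal_le (e₁ e₂ v : Vec3) (θ : ℝ) :
    |v ⬝ᵥ planeNormal e₁ e₂ θ| ≤ |v ⬝ᵥ e₁| + |v ⬝ᵥ e₂| := by
  rw [planeNormal, dotProduct_sub, dotProduct_smul, dotProduct_smul, smul_eq_mul, smul_eq_mul]
  refine (abs_sub _ _).trans (add_le_add ?_ ?_) <;> rw [abs_mul] <;>
    refine mul_le_of_le_one_left (abs_nonneg _) ?_
  exacts [Real.abs_sin_le_one θ, Real.abs_cos_le_one θ]

/-- An orthonormal frame adapted to the axis, positively oriented. -/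
theorem IsCrossSection.exists_frame {e : Vec3} (he : e ⬝ᵥ e = 1) {c : ℝ → Vec3} {L : ℝ}
    (hc : IsCrossSection e c L) :
    ∃ e₁ e₂ : Vec3, IsFrame e₁ e₂ e ∧ e ⨯₃ e₁ = e₂ ∧ e ⨯₃ e₂ = -e₁ := by
  set d := deriv c 0
  have hd : 0 < d ⬝ᵥ d := by
    have h0 : 0 ≤ d ⬝ᵥ d := by
      rw [_root_.dotProduct, Fin.sum_univ_three]; nlinarith [mul_self_nonneg (d 0),
        mul_self_nonneg (d 1), mul_self_nonneg (d 2)]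
    exact lt_of_le_of_ne h0 fun h => hc.regular 0 (dotProduct_self_eq_zero.1 h.symm)
  set e₁ := (Real.sqrt (d ⬝ᵥ d))⁻¹ • d with he₁
  have h11 : e₁ ⬝ᵥ e₁ = 1 := by
    have hs := Real.sqrt_pos.2 hd
    rw [he₁, smul_dotProduct, dotProduct_smul, smul_eq_mul, smul_eq_mul]
    field_simp
    rw [Real.sq_sqrt hd.le]
  have h1e : e₁ ⬝ᵥ e = 0 := by rw [he₁, smul_dotProduct, hc.deriv_dot_axis, smul_zero]
  have hf := isFrame_cross he h11 h1e
  refine ⟨e₁, e ⨯₃ e₁, ⟨hf.vv, hf.ww, hf.uu, hf.vw, h1e, ?_⟩, rfl, ?_⟩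
  · rw [dotProduct_comm]; exact hf.uw
  · have he1 : e ⬝ᵥ e₁ = 0 := by rw [dotProduct_comm, h1e]
    rw [cross_cross_eq_smul_sub_smul', he1, he, zero_smul, one_smul, zero_sub]

end Plane

/-! ### Bound of the height -/

section Boundedness

variable {e : Vec3} {c : ℝ → Vec3} {L : ℝ} {ν : Vec3 → Vec3}

/-- Tangent angle of the cross-section, in an orthonormal frame adapted to the axis. -/
structure IsTangentAngle (e₁ e₂ : Vec3) (c : ℝ → Vec3) (L : ℝ) (ρ Θ : ℝ → ℝ) : Prop where
  pos : ∀ s, 0 < ρ s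
  continuous_speed : Continuous ρ
  periodic_speed : Function.Periodic ρ L
  continuous_angle : Continuous Θ
  differentiable_angle : ∀ s, DifferentiableAt ℝ Θ s
  angle_add : ∃ σ : ℝ, (σ = 1 ∨ σ = -1) ∧ ∀ s, Θ (s + L) = Θ s + σ * (2 * Real.pi)
  deriv_eq : ∀ s, deriv c s = ρ s • planeUnit e₁ e₂ (Θ s)

theorem IsCrossSection.planeCoord_injOn (hc : IsCrossSection e c L) {e₁ e₂ : Vec3}
    (hf : IsFrame e₁ e₂ e) : InjOn (fun s => planeCoord e₁ e₂ (c s)) (Ico 0 L) :=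
  fun s hs t ht h => hc.injOn hs ht (hf.eq_of_planeCoord_eq h (by rw [hc.perp, hc.perp]))

theorem IsCrossSection.hasDerivAt_planeCoord (hc : IsCrossSection e c L) (e₁ e₂ : Vec3) (s : ℝ) :
    HasDerivAt (fun s => planeCoord e₁ e₂ (c s)) (planeCoord e₁ e₂ (deriv c s)) s :=
  (planeCoord e₁ e₂).hasFDerivAt.comp_hasDerivAt s
    (hc.contDiff.differentiable two_ne_zero s).hasDerivAt

theorem IsCrossSection.contDiff_planeCoord (hc : IsCrossSection e c L) (e₁ e₂ : Vec3) :
    ContDiff ℝ 2 (fun s => planeCoord e₁ e₂ (c s)) :=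
  (planeCoord e₁ e₂).contDiff.comp hc.contDiff

theorem IsCrossSection.planeCoord_deriv_ne_zero (hc : IsCrossSection e c L) {e₁ e₂ : Vec3}
    (hf : IsFrame e₁ e₂ e) (s : ℝ) : planeCoord e₁ e₂ (deriv c s) ≠ 0 := fun h =>
  hc.regular s (hf.eq_of_planeCoord_eq (by rw [h, map_zero])
    (by rw [hc.deriv_dot_axis, zero_dotProduct]))

theorem IsCrossSection.exists_isTangentAngle (hc : IsCrossSection e c L) {e₁ e₂ : Vec3}
    (hf : IsFrame e₁ e₂ e) : ∃ ρ Θ : ℝ → ℝ, IsTangentAngle e₁ e₂ c L ρ Θ := by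
  set C : ℝ → ℂ := fun s => planeCoord e₁ e₂ (c s) with hC
  have hC2 : ContDiff ℝ 2 C := hc.contDiff_planeCoord e₁ e₂
  have hC1 : ContDiff ℝ 1 C := hC2.of_le one_le_two
  have hd : ∀ s, deriv C s = planeCoord e₁ e₂ (deriv c s) := fun s =>
    (hc.hasDerivAt_planeCoord e₁ e₂ s).deriv
  have hreg : ∀ s, deriv C s ≠ 0 := fun s => by
    rw [hd]; exact hc.planeCoord_deriv_ne_zero hf s
  have hper : Function.Periodic C L := fun s => by simp only [hC, hc.periodic s]
  obtain ⟨Θ, hΘ, hΘe, hσ⟩ := exists_tangent_angle hc.pos hC1 hper (hc.planeCoord_injOn hf) hreg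
  have hdd : Differentiable ℝ (deriv C) :=
    ((contDiff_succ_iff_deriv (n := 1)).1
      (by simpa [one_add_one_eq_two] using hC2)).2.2.differentiable one_ne_zero
  have hdc := hC1.continuous_deriv le_rfl
  refine ⟨fun s => ‖deriv C s‖, Θ, fun s => norm_pos_iff.2 (hreg s), by fun_prop, fun s => ?_, hΘ,
    fun s => (hasDerivAt_angle hΘ.continuousAt hΘe (hdd s).hasDerivAt (hreg s)).differentiableAt,
    hσ, fun s => ?_⟩
  · have : deriv C (s + L) = deriv C s := by
      rw [← deriv_comp_add_const]
      congr 1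
      exact funext hper
    simp only [this]
  · have h1 := hΘe s
    rw [hd s] at h1
    rw [hd s]
    refine hf.eq_of_planeCoord_eq ?_ ?_
    · rw [map_smul, hf.planeCoord_planeUnit, Complex.real_smul]
      exact h1
    · rw [hc.deriv_dot_axis, smul_dotProduct, dotProduct_comm, (hf.plane _).uv, smul_zero]

/-- At each point the normal is `±` the rotated tangent; the sign is continuous in the parameters
`(s, h)`, which range over a connected plane. -/
theorem IsUnitNormal.exists_eq_planeNormal (hν : IsUnitNormal e c ν) (hc : IsCrossSection e c L)
    {e₁ e₂ : Vec3} (hf : IsFrame e₁ e₂ e) {ρ Θ : ℝ → ℝ} (hΘ : IsTangentAngle e₁ e₂ c L ρ Θ) :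
    ∃ ε : ℝ, ε ^ 2 = 1 ∧ ∀ s h : ℝ, ν (c s + h • e) = ε • planeNormal e₁ e₂ (Θ s) := by
  set β : ℝ × ℝ → ℝ := fun p => ν (c p.1 + p.2 • e) ⬝ᵥ planeNormal e₁ e₂ (Θ p.1) with hβ
  have hmem : ∀ s h : ℝ, c s + h • e ∈ cylinder e c := fun s h => ⟨s, h, rfl⟩
  have hβν : ∀ s h : ℝ, ν (c s + h • e) = β (s, h) • planeNormal e₁ e₂ (Θ s) := by
    intro s h
    have h1 := (hf.plane (Θ s)).expand (ν (c s + h • e))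
    have h2 : ν (c s + h • e) ⬝ᵥ planeUnit e₁ e₂ (Θ s) = 0 := by
      have := hν.dot_deriv s h
      rw [hΘ.deriv_eq, dotProduct_smul, smul_eq_mul] at this
      exact (mul_eq_zero.1 this).resolve_left (hΘ.pos s).ne'
    rw [hν.dot_axis (hmem s h), h2, zero_smul, zero_smul, zero_add, zero_add] at h1
    exact h1
  have hβ2 : ∀ p, β p ^ 2 = 1 := by
    rintro ⟨s, h⟩
    have h1 := hν.unit _ (hmem s h)
    rw [hβν, smul_dotProduct, dotProduct_smul, (hf.plane (Θ s)).ww] at h1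
    simpa [sq] using h1
  have hβc : Continuous β := by
    have hcc := hc.contDiff.continuous
    have hΘc := hΘ.continuous_angle
    have h1 : Continuous fun p : ℝ × ℝ => ν (c p.1 + p.2 • e) :=
      hν.continuousOn.comp_continuous (by fun_prop) fun p => hmem p.1 p.2
    have h2 : Continuous fun p : ℝ × ℝ => planeNormal e₁ e₂ (Θ p.1) := by
      unfold planeNormal; fun_prop
    exact h1.dotProduct h2
  have hconst : ∀ p, β p = β (0, 0) := fun p => by
    refine isPreconnected_univ.eq_of_sq_eq (f := β) (g := fun _ => β (0, 0)) hβc.continuousOn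
      continuousOn_const (fun p _ => ?_) (fun _ h => ?_) (mem_univ (0, 0)) rfl (mem_univ p)
    · simp only [Pi.pow_apply, hβ2]
    · have := hβ2 (0, 0)
      rw [h] at this
      norm_num at this
  exact ⟨β (0, 0), hβ2 _, fun s h => by rw [hβν, hconst]⟩

/-- A bound of the height that depends only on the value of the angular velocity at one time. -/
theorem IsReducedMotion.exists_abs_height_sub_le {r γ g : ℝ} (hr : 0 < r) (hγ : 0 < γ)
    (he : e ⬝ᵥ e = 1) (hc : IsCrossSection e c L) (hν : IsUnitNormal e c ν) {I : Set ℝ}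
    (hI : I.OrdConnected) {ω ω' a a'' : ℝ → Vec3}
    (hm : IsReducedMotion r γ g e I ω ω' a a'' (fun t => ν (a t)))
    (ha : ∀ t ∈ I, a t ∈ cylinder e c) {k : ℝ} (hk : k ≠ 0) (hωk : ∀ t ∈ I, ω t ⬝ᵥ e = k)
    {t₀ : ℝ} (ht₀ : t₀ ∈ I) : ∃ B, ∀ t ∈ I, |a t ⬝ᵥ e - a t₀ ⬝ᵥ e| ≤ B := by
  obtain ⟨e₁, e₂, hf, hee₁, hee₂⟩ := hc.exists_frame he
  obtain ⟨ρ, Θ, hΘ⟩ := hc.exists_isTangentAngle hf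
  obtain ⟨ε, hε, hνε⟩ := hν.exists_eq_planeNormal hc hf hΘ
  obtain ⟨σ, hσ, hΘσ⟩ := hΘ.angle_add
  have hε0 : ε ≠ 0 := fun h => by rw [h] at hε; norm_num at hε
  set η := Real.sqrt (γ ^ 2 / (1 + γ ^ 2)) with hη
  have hγ1 : (0 : ℝ) < 1 + γ ^ 2 := by positivity
  have hηsq : η ^ 2 = γ ^ 2 / (1 + γ ^ 2) := Real.sq_sqrt (by positivity)
  have hη0 : 0 < η := Real.sqrt_pos.2 (by positivity)
  have hη1 : η < 1 := by
    have : η ^ 2 < 1 := by rw [hηsq, div_lt_one hγ1]; linarith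
    nlinarith
  obtain ⟨M, hM⟩ := exists_norm_integral_exp_angle_le hc.pos hΘ.continuous_angle
    hΘ.continuous_speed hΘ.periodic_speed hσ hΘσ hη0 hη1
  set P : ℝ → ℂ := fun s =>
    ∫ u in (0 : ℝ)..s, (ρ u : ℂ) * Complex.exp (-(η * Θ u * Complex.I)) with hP
  have hPd : ∀ s, HasDerivAt P ((ρ s : ℂ) * Complex.exp (-(η * Θ s * Complex.I))) s := fun s => by
    have h1 := hΘ.continuous_angle
    have h2 := hΘ.continuous_speed
    have h3 : Continuous fun u => (ρ u : ℂ) * Complex.exp (-(η * Θ u * Complex.I)) := by fun_prop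
    exact intervalIntegral.integral_hasDerivAt_right (h3.intervalIntegrable _ _)
      h3.stronglyMeasurable.stronglyMeasurableAtFilter h3.continuousAt
  set G := g / (r * (1 + γ ^ 2)) with hG
  have hκ : r * k * ε ≠ 0 := by positivity
  -- `B` is fixed before `t`, since the lift built below depends on the interval between `t₀` and
  -- `t`. The amplitude bound uses fixed axes, so it does not depend on the angle that the lift
  -- assigns to `t₀`.
  obtain ⟨B, hB⟩ := _root_.exists_abs_height_sub_le η G r (r * k * ε) M
    ((|ω t₀ ⬝ᵥ e₁| + |ω t₀ ⬝ᵥ e₂|) + (|ω t₀ ⬝ᵥ e₁| + |ω t₀ ⬝ᵥ e₂|)) hκ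
  refine ⟨|B|, fun t ht => ?_⟩
  rcases eq_or_ne t t₀ with rfl | hne
  · simp
  -- the motion on the interval between `t₀` and `t`
  set J := Icc (min t₀ t) (max t₀ t) with hJ
  have hlt : min t₀ t < max t₀ t := min_lt_max.2 hne.symm
  have htJ : t ∈ J := ⟨min_le_right _ _, le_max_right _ _⟩
  have ht₀J : t₀ ∈ J := ⟨min_le_left _ _, le_max_left _ _⟩
  have hJI : J ⊆ I := hI.uIcc_subset ht₀ ht
  have hJu : UniqueDiffOn ℝ J := uniqueDiffOn_Icc hlt
  have da : ∀ u ∈ J, HasDerivWithinAt a (r • (ω u ⨯₃ ν (a u))) J u := fun u hu =>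
    (hm.center u (hJI hu)).mono hJI
  have dω : ∀ u ∈ J, HasDerivWithinAt ω (ω' u) J u := fun u hu =>
    (hm.angular u (hJI hu)).mono hJI
  have dv : ∀ u ∈ J, HasDerivWithinAt (fun t => r • (ω t ⨯₃ ν (a t))) (a'' u) J u := fun u hu =>
    (hm.velocity u (hJI hu)).mono hJI
  set C : ℝ → ℂ := fun s => planeCoord e₁ e₂ (c s) with hC
  have hC1 : ContDiff ℝ 1 C := (hc.contDiff_planeCoord e₁ e₂).of_le one_le_two
  set p : ℝ → ℂ := fun u => planeCoord e₁ e₂ (a u) with hp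
  have dp : ∀ u ∈ J, HasDerivWithinAt p (planeCoord e₁ e₂ (r • (ω u ⨯₃ ν (a u)))) J u :=
    fun u hu => (planeCoord e₁ e₂).hasFDerivAt.comp_hasDerivWithinAt u (da u hu)
  have hπe : planeCoord e₁ e₂ e = 0 := by
    have h1 := hf.uw
    have h2 := hf.vw
    rw [dotProduct_comm] at h1 h2
    rw [planeCoord_apply, h1, h2]
    rfl
  obtain ⟨s, hs, hsp⟩ := exists_lift_on_Icc hc.pos hC1.continuous
    (fun u => by simp only [hC, hc.periodic u]) (hc.planeCoord_injOn hf) hlt.le (p := p)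
    (fun u hu => (dp u hu).continuousWithinAt) (fun u hu => by
      obtain ⟨s, h, hsh⟩ := ha u (hJI hu)
      exact ⟨s, by simp only [hC, hp, hsh, map_add, map_smul, hπe, smul_zero, add_zero]⟩)
  have hsa : ∀ u ∈ J, a u = c (s u) + (a u ⬝ᵥ e) • e := fun u hu => by
    refine hf.eq_of_planeCoord_eq ?_ ?_
    · rw [map_add, map_smul, hπe, smul_zero, add_zero]
      exact (hsp u hu).symm
    · rw [add_dotProduct, hc.perp, smul_dotProduct, he, smul_eq_mul, mul_one, zero_add]
  have hνs : ∀ u ∈ J, ν (a u) = ε • planeNormal e₁ e₂ (Θ (s u)) := fun u hu => by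
    rw [hsa u hu]; exact hνε _ _
  have hcross : ∀ θ, planeNormal e₁ e₂ θ ⨯₃ e = -planeUnit e₁ e₂ θ := fun θ => by
    rw [← cross_anticomm, planeNormal, planeUnit, map_sub, map_smul, map_smul, hee₁, hee₂]
    ext i; simp; ring
  have hcross' : ∀ θ, planeUnit e₁ e₂ θ ⨯₃ planeNormal e₁ e₂ θ = -e := fun θ => by
    have h1 := hcross θ
    rw [← neg_eq_iff_eq_neg, cross_anticomm] at h1
    have hfθ := hf.plane θ
    rw [← h1, ← cross_anticomm, cross_cross_eq_smul_sub_smul', hfθ.ww]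
    rw [hfθ.uw, zero_smul, one_smul, sub_zero]
  -- axial velocity
  have hve : ∀ u ∈ J, (r • (ω u ⨯₃ ν (a u))) ⬝ᵥ e
      = -r * (ε * (ω u ⬝ᵥ planeUnit e₁ e₂ (Θ (s u)))) := fun u hu => by
    rw [hνs u hu, smul_dotProduct, dotProduct_comm, triple_product_permutation, map_smul,
      LinearMap.smul_apply, hcross, dotProduct_smul, dotProduct_neg]
    simp only [smul_eq_mul]
    ring
  -- the velocity of the lift
  have hvelp : ∀ u ∈ J, planeCoord e₁ e₂ (r • (ω u ⨯₃ ν (a u)))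
      = ((r * k * ε : ℝ) : ℂ) * Complex.exp (Θ (s u) * Complex.I) := fun u hu => by
    have hn := hνs u hu
    have hfr := hf.plane (Θ (s u))
    have h1 := hfr.expand (r • (ω u ⨯₃ ν (a u)))
    have h2 : (r • (ω u ⨯₃ ν (a u))) ⬝ᵥ planeNormal e₁ e₂ (Θ (s u)) = 0 := by
      rw [hn, map_smul, smul_dotProduct, smul_dotProduct, dotProduct_comm, dot_cross_self,
        smul_zero, smul_zero]
    have h3 : planeUnit e₁ e₂ (Θ (s u)) = e ⨯₃ planeNormal e₁ e₂ (Θ (s u)) := by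
      rw [← cross_anticomm, hcross, neg_neg]
    have h4 : (r • (ω u ⨯₃ ν (a u))) ⬝ᵥ planeUnit e₁ e₂ (Θ (s u)) = r * k * ε := by
      have h5 := hfr.uw
      rw [dotProduct_comm] at h5
      rw [hn, map_smul, smul_dotProduct, smul_dotProduct, h3, cross_dot_cross, hfr.ww, h5,
        hωk u (hJI hu)]
      simp only [smul_eq_mul]
      ring
    rw [h1, h2, h4, map_add, map_add, map_smul, map_smul, hπe, zero_smul, map_zero, smul_zero,
      zero_add, add_zero, hf.planeCoord_planeUnit, Complex.real_smul]
  -- The horizontal velocity has constant component `r k ε` along the tangent, so the parameter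
  -- moves at this rate divided by the speed `ρ`.
  have hds : ∀ u ∈ J, HasDerivWithinAt s (r * k * ε / ρ (s u)) J u := fun u hu => by
    have hCd : deriv C (s u) = (ρ (s u) : ℂ) * Complex.exp (Θ (s u) * Complex.I) := by
      rw [(hc.hasDerivAt_planeCoord e₁ e₂ (s u)).deriv, hΘ.deriv_eq, map_smul,
        hf.planeCoord_planeUnit, Complex.real_smul]
    have hρ0 := (hΘ.pos (s u)).ne'
    have hCd0 : deriv C (s u) ≠ 0 := by
      rw [hCd]
      exact mul_ne_zero (by exact_mod_cast hρ0) (Complex.exp_ne_zero _)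
    obtain ⟨s', h1, h2⟩ := hasDerivWithinAt_of_comp_curve hC1 hCd0 hs.continuousWithinAt hsp hu
      (hJu u hu) (dp u hu)
    rw [hvelp u hu, hCd, ← mul_assoc] at h2
    have h3 := mul_right_cancel₀ (Complex.exp_ne_zero _) h2
    have h4 : s' * ρ (s u) = r * k * ε := by exact_mod_cast h3
    rwa [← h4, mul_div_cancel_right₀ _ hρ0]
  set θ : ℝ → ℝ := fun u => Θ (s u) with hθ
  set θ' : ℝ → ℝ := fun u => deriv Θ (s u) * (r * k * ε / ρ (s u)) with hθ'
  have dθ : ∀ u ∈ J, HasDerivWithinAt θ (θ' u) J u := fun u hu =>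
    (hΘ.differentiable_angle (s u)).hasDerivAt.comp_hasDerivWithinAt u (hds u hu)
  set x : ℝ → ℝ := fun u => ε * (ω u ⬝ᵥ planeUnit e₁ e₂ (θ u)) with hx
  set y : ℝ → ℝ := fun u => ε * (ω u ⬝ᵥ planeNormal e₁ e₂ (θ u)) with hy
  have dx : ∀ u ∈ J, HasDerivWithinAt x (ε * (ω' u ⬝ᵥ planeUnit e₁ e₂ (θ u)) - θ' u * y u) J u :=
    fun u hu => ((hasDerivWithinAt_dot_planeUnit (dω u hu) (dθ u hu)).const_mul ε).congr_deriv
      (by simp only [hy]; ring)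
  have dy : ∀ u ∈ J, HasDerivWithinAt y
      (ε * (ω' u ⬝ᵥ planeNormal e₁ e₂ (θ u)) + θ' u * x u) J u :=
    fun u hu => ((hasDerivWithinAt_dot_planeNormal (dω u hu) (dθ u hu)).const_mul ε).congr_deriv
      (by simp only [hx]; ring)
  have dh : ∀ u ∈ J, HasDerivWithinAt (fun u => a u ⬝ᵥ e) (-r * x u) J u := fun u hu =>
    ((da u hu).dotProduct_const e).congr_deriv (hve u hu)
  -- The vertical velocity equals `-r x`, whose derivative is known, so again `ν` need not be
  -- differentiated.
  have hacc : ∀ u ∈ J, a'' u ⬝ᵥ e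
      = -r * (ε * (ω' u ⬝ᵥ planeUnit e₁ e₂ (θ u)) - θ' u * y u) := fun u hu =>
    (hJu u hu).eq_deriv _ ((dv u hu).dotProduct_const e)
      (((dx u hu).const_mul (-r)).congr (fun w hw => hve w hw) (hve u hu))
  have hnormal : ∀ u ∈ J, ω' u ⬝ᵥ planeNormal e₁ e₂ (θ u) = 0 := fun u hu => by
    have h1 := hm.newton u (hJI hu) (planeNormal e₁ e₂ (θ u))
    rw [hνs u hu, map_smul, cross_self, smul_zero, dotProduct_zero, mul_zero, add_zero] at h1
    exact (mul_eq_zero.1 h1).resolve_left (by positivity)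
  have htangent : ∀ u ∈ J, r * γ ^ 2 * (ε * (ω' u ⬝ᵥ planeUnit e₁ e₂ (θ u)))
      = a'' u ⬝ᵥ e - g := fun u hu => by
    have h1 := hm.newton u (hJI hu) (planeUnit e₁ e₂ (θ u))
    rw [hνs u hu, map_smul, hcross', dotProduct_smul, dotProduct_neg, sub_dotProduct,
      smul_dotProduct, he] at h1
    simp only [smul_eq_mul, mul_one] at h1
    have h2 : r * (r * γ ^ 2 * (ε * (ω' u ⬝ᵥ planeUnit e₁ e₂ (θ u)))) = r * (a'' u ⬝ᵥ e - g) := by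
      linear_combination ε * h1 + r * (a'' u ⬝ᵥ e - g) * hε
    exact mul_left_cancel₀ hr.ne' h2
  refine (hB J x y (fun u => a u ⬝ᵥ e) θ θ' (fun u => P (s u)) ordConnected_Icc ?_ ?_ dh dθ ?_ ?_
    t₀ ht₀J ?_ t htJ).trans (le_abs_self B)
  -- Eliminating the vertical acceleration between `htangent` and `hacc` produces the factor `1 +
  -- γ²`, hence the values of `η` and `G`.
  · intro u hu
    refine (dx u hu).congr_deriv ?_
    have h1 := htangent u hu
    rw [hacc u hu] at h1
    rw [hηsq, hG]
    field_simp
    linear_combination h1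
  · intro u hu
    refine (dy u hu).congr_deriv ?_
    rw [hnormal u hu, mul_zero, zero_add]
  -- Change of variables: the speed `ρ` in the integrand of `P` cancels against the rate of the
  -- lift.
  · intro u hu
    refine ((hPd (s u)).scomp_hasDerivWithinAt u (hds u hu)).congr_deriv ?_
    have hρ0 : (ρ (s u) : ℂ) ≠ 0 := by exact_mod_cast (hΘ.pos (s u)).ne'
    rw [Complex.real_smul]
    push_cast
    field_simp
    simp only [hθ]
    ring_nf
  · exact fun u _ => hM (s u)
  · have hεa : |ε| = 1 := by rwa [← sq_eq_sq₀ (abs_nonneg _) zero_le_one, sq_abs, one_pow]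
    refine (norm_add_le _ _).trans (add_le_add ?_ ?_)
    · rw [Complex.norm_real, Real.norm_eq_abs, abs_mul, hεa, one_mul]
      exact abs_dot_planeUnit_le _ _ _ _
    · rw [norm_mul, Complex.norm_I, mul_one, norm_mul, Complex.norm_real, Complex.norm_real,
        Real.norm_eq_abs, Real.norm_eq_abs, abs_mul, hεa, one_mul, abs_of_pos hη0]
      exact (mul_le_of_le_one_left (abs_nonneg _) hη1.le).trans (abs_dot_planeNormal_le _ _ _ _)

/-- A subset of the cylinder on which the height is bounded is bounded. -/
theorem IsCrossSection.isBounded_image (hc : IsCrossSection e c L) (he : e ⬝ᵥ e = 1) {I : Set ℝ}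
    {a : ℝ → Vec3} (ha : ∀ t ∈ I, a t ∈ cylinder e c) {h₀ B : ℝ}
    (hB : ∀ t ∈ I, |a t ⬝ᵥ e - h₀| ≤ B) : Bornology.IsBounded (a '' I) := by
  obtain ⟨M, hM⟩ := (hc.periodic.isBounded_of_continuous hc.pos.ne'
    hc.contDiff.continuous).exists_norm_le
  refine isBounded_iff_forall_norm_le.2 ⟨M + (B + |h₀|) * ‖e‖, ?_⟩
  rintro _ ⟨t, ht, rfl⟩
  obtain ⟨s, h, hsh⟩ := ha t ht
  have hh : a t ⬝ᵥ e = h := by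
    rw [hsh, add_dotProduct, hc.perp, smul_dotProduct, he, smul_eq_mul, mul_one, zero_add]
  have h1 := hB t ht
  rw [hh] at h1
  rw [hsh]
  refine (norm_add_le _ _).trans (add_le_add (hM _ ⟨s, rfl⟩) ?_)
  rw [norm_smul, Real.norm_eq_abs]
  refine mul_le_mul_of_nonneg_right ?_ (norm_nonneg _)
  linarith [abs_sub_abs_le_abs_sub h h₀]

end Boundedness

theorem mainTheorem6 (m r γ φ : ℝ) (hm : 0 < m) (hr : 0 < r) (hγ : 0 < γ)
    (e : Vec3) (he : e ⬝ᵥ e = 1)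
    (c : ℝ → Vec3) (L : ℝ) (hc : IsCrossSection e c L)
    (ν : Vec3 → Vec3) (hν : IsUnitNormal e c ν)
    (I : Set ℝ) (hI : I.OrdConnected)
    (q : ℝ → Mat3 × Vec3) (hq : IsRollingMotion m r γ φ e c ν I q) :
    (∀ t₁ ∈ I, ∀ t₂ ∈ I, angularVelocity I q t₁ ⬝ᵥ e = angularVelocity I q t₂ ⬝ᵥ e) ∧
      ((∃ t ∈ I, angularVelocity I q t ⬝ᵥ e ≠ 0) →
        Bornology.IsBounded ((fun t => (q t).2) '' I)) := by
  -- On a one-point interval derivatives are not unique, but both claims are trivial there.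
  rcases I.subsingleton_or_nontrivial with hs | hnt
  · exact ⟨fun t₁ h₁ t₂ h₂ => by rw [hs h₁ h₂], fun _ => (hs.image _).finite.isBounded⟩
  have hIu : UniqueDiffOn ℝ I := by
    refine uniqueDiffOn_convex hI.convex ?_
    obtain ⟨x, hx, y, hy, hxy⟩ := hnt.exists_lt
    refine (nonempty_Ioo.2 hxy).mono ?_
    rw [← interior_Icc]
    exact interior_mono (hI.out hx hy)
  obtain ⟨ω', a'', hred⟩ := hq.exists_isReducedMotion hm he hc hν hIu
  have hconst : ∀ t₁ ∈ I, ∀ t₂ ∈ I,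
      angularVelocity I q t₁ ⬝ᵥ e = angularVelocity I q t₂ ⬝ᵥ e := fun t₁ h₁ t₂ h₂ =>
    hred.axial_eq hr he hIu hI (fun t ht => hν.unit _ (hq.mem_cylinder t ht))
      (fun t ht => hν.dot_axis (hq.mem_cylinder t ht)) h₁ h₂
  refine ⟨hconst, ?_⟩
  rintro ⟨t₀, ht₀, hk⟩
  obtain ⟨B, hB⟩ := hred.exists_abs_height_sub_le hr hγ he hc hν hI hq.mem_cylinder hk
    (fun t ht => hconst t ht t₀ ht₀) ht₀
  exact hc.isBounded_image he hq.mem_cylinder hB
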